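/- **Setting.** A realization is a tuple $(\mathcal H,\rho,H,M)$ of a complex Hilbert space, a density operator $\rho$, a self-adjoint (possibly unbounded) operator $H\ge 0$ and a two-outcome POVM $M=(M_0,M_1)$. Its timeline is $P(a|t)=\mathrm{tr}(e^{-iHt}\rho e^{iHt}M_a)$, $a\in\{0,1\}$, $t\in\mathbb R$. For $E^+>0$ let $S(E^+;\tfrac12)$ be the set of timelines of realizations in which the energy of $\rho$ is above or equal to $E^+$ with probability at most $\tfrac12$, i.e. $\mathrm{tr}(\rho\,\mathbf 1_{[E^+,\infty)}(H))\le\tfrac12$; for $\vec t=(t_1,\dots,t_N)$ let $S(E^+;\tfrac12,\vec t)$ be the set of datasets $(P(a|t_j))_{a,j}$ with $P\in S(E^+;\tfrac12)$. For $\Delta>0$ and $\delta\ge0$ we say that $P$ fits $(\tilde P,\delta)$ if $\sum_a|P(a|t_j)-\tilde P(a|t_j)|\le\delta$ for $t_1=0$, $t_2=\Delta$, where $\tilde P(0|0)=1$, $\tilde P(1|0)=0$, $\tilde P(0|\Delta)=0$, $\tilde P(1|\Delta)=1$. Let $\tau_m=2\Delta+\frac{\Delta}{2m+1}$, $m=0,1,2,\dots$,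 so that $\tau_m\to2\Delta$. **Statement.** 1. There are absolute constants $C_1,C_2>0$ such that for all $E^+>0$, $0<\Delta\le\frac{\pi}{2E^+}$, $\delta\ge0$ and every $P\in S(E^+;\tfrac12)$ that fits $(\tilde P,\delta)$, $$1-P(0|2\Delta)\le\sqrt{C_1\sqrt\delta+C_2(E^+\Delta)^2}.$$ 2. For all $E^+,\Delta>0$ and all $m$, the realization $(\mathbb C^2,|+\rangle\langle+|,H_m,M)$ with $|+\rangle=\frac1{\sqrt2}(|0\rangle+|1\rangle)$, $H_m=\frac{(2m+1)\pi}{\Delta}|1\rangle\langle1|$, $M_0=|+\rangle\langle+|$, $M_1=\mathbb I-M_0$ satisfies the energy constraint of $S(E^+;\tfrac12)$, and its timeline $P_m$ fits $\tilde P$ exactly and has $P_m(0|\tau_m)=0$. Consequently, for every $\delta\ge0$, the minimum of $P(0|\tau_m)$ over all $P\in S(E^+;\tfrac12)$ that fit $(\tilde P,\delta)$ is $0$, and the dataset $D$ with $D(0|\cdot)=(1,0,0)$, $D(1|\cdot)=(0,1,1)$ lies in $S(E^+;\tfrac12,(0,\Delta,\tau_m))$ for every $m$. 3. There is an absolute constant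 $c>0$ such that, whenever $E^+,\Delta>0$ and $E^+\Delta\le c$, the dataset $D$ is not in the closure of $S(E^+;\tfrac12,(0,\Delta,2\Delta))$, and the set-valued map $\vec t\mapsto S(E^+;\tfrac12,\vec t)$, $\vec t\in\mathbb R^3$, is not continuous at $\vec t=(0,\Delta,2\Delta)$ in the Hausdorff distance. -/

import Mathlib

open MeasureTheory Filter Topology

noncomputable section

namespace TimedMeasurement

/-- A spectral measure on `ℝ` (a projection-valued measure, or resolution of the identity): to each
Borel set `A` it assigns an orthogonal projection `proj A`, countably additively in the strong
operator topology.  The values on non-measurable sets play no role. -/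
structure SpectralMeasure (𝓗 : Type*) [NormedAddCommGroup 𝓗] [InnerProductSpace ℂ 𝓗]
    [CompleteSpace 𝓗] where
  proj : Set ℝ → 𝓗 →L[ℂ] 𝓗
  isStarProjection : ∀ A, MeasurableSet A → IsStarProjection (proj A)
  proj_univ : proj Set.univ = 1
  proj_inter : ∀ A B, MeasurableSet A → MeasurableSet B → proj (A ∩ B) = proj A * proj B
  hasSum_iUnion : ∀ A : ℕ → Set ℝ, (∀ n, MeasurableSet (A n)) →
    Pairwise (Function.onFun Disjoint A) →
      ∀ ψ : 𝓗, HasSum (fun n => proj (A n) ψ) (proj (⋃ n, A n) ψ)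

namespace SpectralMeasure

variable {𝓗 : Type*} [NormedAddCommGroup 𝓗] [InnerProductSpace ℂ 𝓗] [CompleteSpace 𝓗]

theorem proj_empty (E : SpectralMeasure 𝓗) : E.proj ∅ = 0 := by
  ext ψ
  have h := E.hasSum_iUnion (fun _ => ∅) (fun _ => MeasurableSet.empty)
    (fun _ _ _ => by simp [Function.onFun]) ψ
  have h2 := h.summable.tendsto_atTop_zero
  simpa using (tendsto_nhds_unique h2 tendsto_const_nhds).symm

theorem inner_proj (E : SpectralMeasure 𝓗) {A : Set ℝ} (hA : MeasurableSet A) (ψ : 𝓗) :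
    inner ℂ ψ (E.proj A ψ) = ((‖E.proj A ψ‖ ^ 2 : ℝ) : ℂ) := by
  have h1 : E.proj A (E.proj A ψ) = E.proj A ψ := by
    have := (E.isStarProjection A hA).isIdempotentElem
    exact congrArg (fun T : 𝓗 →L[ℂ] 𝓗 => T ψ) this
  have h2 : ContinuousLinearMap.adjoint (E.proj A) = E.proj A :=
    (E.isStarProjection A hA).isSelfAdjoint
  rw [← h1, ← ContinuousLinearMap.adjoint_inner_left, h2, h1, inner_self_eq_norm_sq_to_K]
  norm_cast

/-- The energy distribution `A ↦ ‖E(A)ψ‖² = ⟨ψ, E(A)ψ⟩` of the vector `ψ`. -/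
def measure (E : SpectralMeasure 𝓗) (ψ : 𝓗) : Measure ℝ :=
  Measure.ofMeasurable (fun A _ => ENNReal.ofReal (‖E.proj A ψ‖ ^ 2))
    (by simp [E.proj_empty])
    (by
      intro A hA hd
      have h := (E.hasSum_iUnion A hA hd ψ).mapL (innerSL ℂ ψ)
      simp only [innerSL_apply_apply] at h
      rw [E.inner_proj (MeasurableSet.iUnion hA)] at h
      simp only [E.inner_proj (hA _)] at h
      have h' := Complex.hasSum_ofReal.mp h
      rw [← h'.tsum_eq]
      exact ENNReal.ofReal_tsum_of_nonneg (fun n => by positivity) h'.summable)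

theorem measure_apply (E : SpectralMeasure 𝓗) (ψ : 𝓗) {A : Set ℝ} (hA : MeasurableSet A) :
    E.measure ψ A = ENNReal.ofReal (‖E.proj A ψ‖ ^ 2) :=
  Measure.ofMeasurable_apply A hA

theorem measureReal_apply (E : SpectralMeasure 𝓗) (ψ : 𝓗) {A : Set ℝ} (hA : MeasurableSet A) :
    (E.measure ψ).real A = ‖E.proj A ψ‖ ^ 2 := by
  rw [Measure.real, E.measure_apply ψ hA, ENNReal.toReal_ofReal (by positivity)]

instance (E : SpectralMeasure 𝓗) (ψ : 𝓗) : IsFiniteMeasure (E.measure ψ) :=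
  ⟨by rw [E.measure_apply ψ MeasurableSet.univ]; exact ENNReal.ofReal_lt_top⟩

/-- The integral of a simple function against a spectral measure. -/
def simpleIntegral (E : SpectralMeasure 𝓗) (s : SimpleFunc ℝ ℂ) : 𝓗 →L[ℂ] 𝓗 :=
  ∑ c ∈ s.range, c • E.proj (s ⁻¹' {c})

theorem inner_simpleIntegral (E : SpectralMeasure 𝓗) (s : SimpleFunc ℝ ℂ) (ψ : 𝓗) :
    inner ℂ ψ (E.simpleIntegral s ψ) = ∫ l, s l ∂(E.measure ψ) := by
  classical
  rw [← SimpleFunc.integral_eq_integral _ (SimpleFunc.integrable_of_isFiniteMeasure s),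
    SimpleFunc.integral_eq_sum_of_subset (Finset.filter_subset _ _), simpleIntegral]
  simp only [sum_apply, smul_apply, inner_sum,
    inner_smul_right]
  refine Finset.sum_congr rfl fun c _ => ?_
  rw [E.inner_proj (s.measurableSet_fiber c), E.measureReal_apply ψ (s.measurableSet_fiber c),
    Complex.real_smul, mul_comm]

theorem simpleIntegral_sub (E : SpectralMeasure 𝓗) (s s' : SimpleFunc ℝ ℂ) :
    E.simpleIntegral (s - s') = E.simpleIntegral s - E.simpleIntegral s' := by
  apply ContinuousLinearMap.coe_injective
  rw [← ext_inner_map]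
  intro ψ
  rw [← inner_conj_symm, ← inner_conj_symm (_ : 𝓗) ψ]
  congr 1
  simp only [ContinuousLinearMap.coe_coe, sub_apply, inner_sub_right,
    inner_simpleIntegral, SimpleFunc.coe_sub, Pi.sub_apply]
  exact integral_sub (SimpleFunc.integrable_of_isFiniteMeasure s)
    (SimpleFunc.integrable_of_isFiniteMeasure s')

theorem norm_simpleIntegral_sq (E : SpectralMeasure 𝓗) (s : SimpleFunc ℝ ℂ) (ψ : 𝓗) :
    ‖E.simpleIntegral s ψ‖ ^ 2 = ∫ l, ‖s l‖ ^ 2 ∂(E.measure ψ) := by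
  classical
  have horth : ∀ c d : ℂ, c ≠ d →
      inner ℂ (E.proj (s ⁻¹' {c}) ψ) (E.proj (s ⁻¹' {d}) ψ) = 0 := by
    intro c d hcd
    have h2 : ContinuousLinearMap.adjoint (E.proj (s ⁻¹' {c})) = E.proj (s ⁻¹' {c}) :=
      (E.isStarProjection _ (s.measurableSet_fiber c)).isSelfAdjoint
    have h3 : E.proj (s ⁻¹' {c}) * E.proj (s ⁻¹' {d}) = 0 := by
      rw [← E.proj_inter _ _ (s.measurableSet_fiber c) (s.measurableSet_fiber d),
        ← Set.preimage_inter, Set.singleton_inter_eq_empty.mpr (by simpa using hcd),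
        Set.preimage_empty, E.proj_empty]
    rw [← h2, ContinuousLinearMap.adjoint_inner_left]
    have h4 : E.proj (s ⁻¹' {c}) (E.proj (s ⁻¹' {d}) ψ) = 0 :=
      congrArg (fun T : 𝓗 →L[ℂ] 𝓗 => T ψ) h3
    rw [h4, inner_zero_right]
  have key : ((‖E.simpleIntegral s ψ‖ ^ 2 : ℝ) : ℂ)
      = ((∑ c ∈ s.range, (E.measure ψ).real (s ⁻¹' {c}) • ‖c‖ ^ 2 : ℝ) : ℂ) := by
    have : ((‖E.simpleIntegral s ψ‖ ^ 2 : ℝ) : ℂ)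
        = inner ℂ (E.simpleIntegral s ψ) (E.simpleIntegral s ψ) := by
      rw [inner_self_eq_norm_sq_to_K]; norm_cast
    rw [this, simpleIntegral]
    simp only [sum_apply, smul_apply, sum_inner, inner_sum,
      inner_smul_right, inner_smul_left, Complex.ofReal_sum]
    refine Finset.sum_congr rfl fun c hc => ?_
    rw [Finset.sum_eq_single c]
    · rw [inner_self_eq_norm_sq_to_K, E.measureReal_apply ψ (s.measurableSet_fiber c), ← mul_assoc,
        Complex.mul_conj, Complex.normSq_eq_norm_sq]
      simp [mul_comm]
    · intro d _ hd
      simp [horth _ _ hd]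
    · intro h; exact absurd hc h
  have key' := Complex.ofReal_injective key
  rw [key', ← SimpleFunc.map_integral s (fun c => ‖c‖ ^ 2)
    (SimpleFunc.integrable_of_isFiniteMeasure s) (by simp),
    SimpleFunc.integral_eq_integral _ (SimpleFunc.integrable_of_isFiniteMeasure _)]
  rfl

theorem exists_integral (E : SpectralMeasure 𝓗) (f : ℝ → ℂ) (hf : Measurable f)
    (hb : ∃ C, ∀ l, ‖f l‖ ≤ C) :
    ∃ T : 𝓗 →L[ℂ] 𝓗, ∀ ψ, inner ℂ ψ (T ψ) = ∫ l, f l ∂(E.measure ψ) := by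
  obtain ⟨C, hC⟩ := hb
  let s : ℕ → SimpleFunc ℝ ℂ := SimpleFunc.approxOn f hf Set.univ 0 (Set.mem_univ _)
  have hsb : ∀ n l, ‖s n l‖ ≤ 2 * C := fun n l => by
    have := SimpleFunc.norm_approxOn_zero_le hf (Set.mem_univ (0 : ℂ)) l n
    linarith [hC l]
  have hst : ∀ l, Tendsto (fun n => s n l) atTop (𝓝 (f l)) := fun l =>
    SimpleFunc.tendsto_approxOn hf (Set.mem_univ _) (by simp)
  have hC0 : 0 ≤ C := (norm_nonneg _).trans (hC 0)
  have hint : ∀ (ψ : 𝓗) (n : ℕ), Integrable (fun l => ‖s n l - f l‖ ^ 2) (E.measure ψ) := by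
    intro ψ n
    refine Integrable.of_bound (C := (3 * C) ^ 2)
      ((((s n).measurable.sub hf).norm.pow_const 2).aestronglyMeasurable) ?_
    refine Eventually.of_forall fun l => ?_
    rw [Real.norm_of_nonneg (by positivity)]
    gcongr
    exact (norm_sub_le _ _).trans (by linarith [hsb n l, hC l])
  have hL2 : ∀ ψ, Tendsto (fun n => ∫ l, ‖s n l - f l‖ ^ 2 ∂(E.measure ψ)) atTop (𝓝 0) := by
    intro ψ
    have : Tendsto (fun n => ∫ l, ‖s n l - f l‖ ^ 2 ∂(E.measure ψ)) atTop
        (𝓝 (∫ _, (0 : ℝ) ∂(E.measure ψ))) := by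
      refine tendsto_integral_of_dominated_convergence (fun _ => (3 * C) ^ 2)
        (fun n => (hint ψ n).aestronglyMeasurable) (integrable_const _) (fun n => ?_) ?_
      · refine Eventually.of_forall fun l => ?_
        rw [Real.norm_of_nonneg (by positivity)]
        gcongr
        exact (norm_sub_le _ _).trans (by linarith [hsb n l, hC l])
      · refine Eventually.of_forall fun l => ?_
        have h := ((hst l).sub_const (f l)).norm.pow 2
        simpa using h
    simpa using this
  have hcauchy : ∀ ψ, CauchySeq (fun n => E.simpleIntegral (s n) ψ) := by
    intro ψ
    rw [Metric.cauchySeq_iff]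
    intro ε hε
    obtain ⟨N, hN⟩ := (eventually_atTop.mp
      ((hL2 ψ).eventually (gt_mem_nhds (show (0 : ℝ) < ε ^ 2 / 4 by positivity))))
    refine ⟨N, fun m hm n hn => ?_⟩
    rw [dist_eq_norm, ← sub_apply, ← simpleIntegral_sub]
    refine lt_of_pow_lt_pow_left₀ 2 hε.le ?_
    rw [norm_simpleIntegral_sq]
    calc ∫ l, ‖(s m - s n) l‖ ^ 2 ∂(E.measure ψ)
        ≤ ∫ l, (2 * ‖s m l - f l‖ ^ 2 + 2 * ‖s n l - f l‖ ^ 2) ∂(E.measure ψ) := by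
          refine integral_mono_of_nonneg (Eventually.of_forall fun l => by positivity)
            (((hint ψ m).const_mul 2).add ((hint ψ n).const_mul 2))
            (Eventually.of_forall fun l => ?_)
          have h1 : ‖(s m - s n) l‖ ≤ ‖s m l - f l‖ + ‖s n l - f l‖ := by
            rw [SimpleFunc.coe_sub, Pi.sub_apply,
              show s m l - s n l = (s m l - f l) - (s n l - f l) by ring]
            exact norm_sub_le _ _
          have h2 := norm_nonneg ((s m - s n) l)
          simp only
          nlinarith [sq_nonneg (‖s m l - f l‖ - ‖s n l - f l‖)]
      _ = 2 * ∫ l, ‖s m l - f l‖ ^ 2 ∂(E.measure ψ)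
          + 2 * ∫ l, ‖s n l - f l‖ ^ 2 ∂(E.measure ψ) := by
          rw [integral_add ((hint ψ m).const_mul 2) ((hint ψ n).const_mul 2),
            integral_const_mul, integral_const_mul]
      _ < ε ^ 2 := by linarith [hN m hm, hN n hn]
  choose g hg using fun ψ => cauchySeq_tendsto_of_complete (hcauchy ψ)
  let T : 𝓗 →L[ℂ] 𝓗 := continuousLinearMapOfTendsto (fun n => E.simpleIntegral (s n))
    (f := g) (tendsto_pi_nhds.mpr hg)
  refine ⟨T, fun ψ => ?_⟩
  have h1 : Tendsto (fun n => inner ℂ ψ (E.simpleIntegral (s n) ψ)) atTop (𝓝 (inner ℂ ψ (T ψ))) :=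
    (tendsto_const_nhds (x := ψ)).inner (hg ψ)
  have h2 : Tendsto (fun n => inner ℂ ψ (E.simpleIntegral (s n) ψ)) atTop
      (𝓝 (∫ l, f l ∂(E.measure ψ))) := by
    simp only [inner_simpleIntegral]
    exact tendsto_integral_of_dominated_convergence (fun _ => 2 * C)
      (fun n => (s n).measurable.aestronglyMeasurable) (integrable_const _)
      (fun n => Eventually.of_forall (hsb n)) (Eventually.of_forall hst)
  exact tendsto_nhds_unique h1 h2

theorem exists_evolution (E : SpectralMeasure 𝓗) (t : ℝ) :
    ∃ T : 𝓗 →L[ℂ] 𝓗, ∀ ψ, inner ℂ ψ (T ψ)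
      = ∫ l : ℝ, Complex.exp (-Complex.I * (l : ℂ) * (t : ℂ)) ∂(E.measure ψ) :=
  E.exists_integral _ (by fun_prop) ⟨1, fun l => by simp [Complex.norm_exp]⟩

/-- The evolution operator `e^{-iHt} = ∫ e^{-ilt} dE(l)` of the Hamiltonian `H = ∫ l dE(l)`: the
bounded operator whose quadratic form is `ψ ↦ ∫ e^{-ilt} d⟨ψ, E(l)ψ⟩` (unique by polarization). -/
def evolution (E : SpectralMeasure 𝓗) (t : ℝ) : 𝓗 →L[ℂ] 𝓗 :=
  Classical.choose (E.exists_evolution t)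

theorem inner_evolution (E : SpectralMeasure 𝓗) (t : ℝ) (ψ : 𝓗) :
    inner ℂ ψ (E.evolution t ψ)
      = ∫ l : ℝ, Complex.exp (-Complex.I * (l : ℂ) * (t : ℂ)) ∂(E.measure ψ) :=
  Classical.choose_spec (E.exists_evolution t) ψ

/-- `E` is the spectral measure of the (possibly unbounded) operator `H`, i.e. `H = ∫ l dE(l)`,
with domain the vectors for which `∫ l² d⟨ψ, E(l)ψ⟩` is finite.  By the spectral theorem every
self-adjoint operator has exactly one spectral measure. -/
structure IsResolutionOf (E : SpectralMeasure 𝓗) (H : 𝓗 →ₗ.[ℂ] 𝓗) : Prop where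
  mem_domain_iff : ∀ ψ : 𝓗, ψ ∈ H.domain ↔ Integrable (fun l : ℝ => l ^ 2) (E.measure ψ)
  inner_apply : ∀ ψ : H.domain,
    inner ℂ (ψ : 𝓗) (H ψ) = ((∫ l : ℝ, l ∂(E.measure (ψ : 𝓗)) : ℝ) : ℂ)

end SpectralMeasure

section Trace

variable (𝓗 : Type*) [NormedAddCommGroup 𝓗] [InnerProductSpace ℂ 𝓗] [CompleteSpace 𝓗]

/-- A Hilbert basis of the Hilbert space `𝓗`. -/
def basisSet : Set 𝓗 := Classical.choose (exists_hilbertBasis ℂ 𝓗)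

/-- A Hilbert basis of the Hilbert space `𝓗`. -/
def basis : HilbertBasis (basisSet 𝓗) ℂ 𝓗 :=
  Classical.choose (Classical.choose_spec (exists_hilbertBasis ℂ 𝓗))

variable {𝓗}

/-- The trace of an operator; it is only used for trace-class operators, for which it does not
depend on the basis. -/
def trace (T : 𝓗 →L[ℂ] 𝓗) : ℂ := ∑' i, inner ℂ (basis 𝓗 i) (T (basis 𝓗 i))

/-- Density operators: positive (trace-class) operators of trace one. -/
structure IsDensityOperator (ρ : 𝓗 →L[ℂ] 𝓗) : Prop where
  isPositive : ρ.IsPositive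
  hasSum_one : HasSum (fun i => inner ℂ (basis 𝓗 i) (ρ (basis 𝓗 i))) 1

end Trace

/-- A quantum realization `(𝓗, ρ, H, M)` of a timeline with measurement settings `X` and outcomes
`A`: a state `ρ`, a self-adjoint Hamiltonian `H ≥ 0` (together with its spectral measure), and
for each setting `x` a POVM `(M_{a|x})_a`. -/
structure Realization (𝓗 : Type*) [NormedAddCommGroup 𝓗] [InnerProductSpace ℂ 𝓗]
    [CompleteSpace 𝓗] (X A : Type*) [Fintype A] where
  state : 𝓗 →L[ℂ] 𝓗
  isDensityOperator_state : IsDensityOperator state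
  ham : 𝓗 →ₗ.[ℂ] 𝓗
  isSelfAdjoint_ham : IsSelfAdjoint ham
  ham_nonneg : ∀ ψ : ham.domain, 0 ≤ (inner ℂ (ψ : 𝓗) (ham ψ)).re
  spec : SpectralMeasure 𝓗
  isResolutionOf_spec : spec.IsResolutionOf ham
  meas : X → A → 𝓗 →L[ℂ] 𝓗
  isPositive_meas : ∀ x a, (meas x a).IsPositive
  sum_meas : ∀ x, ∑ a, meas x a = 1

namespace Realization

variable {𝓗 : Type*} [NormedAddCommGroup 𝓗] [InnerProductSpace ℂ 𝓗] [CompleteSpace 𝓗]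
  {X A : Type*} [Fintype A]

/-- `P(a|x,t) = tr(e^{-iHt} ρ e^{iHt} M_{a|x})`. -/
def timeline (R : Realization 𝓗 X A) : X → A → ℝ → ℝ := fun x a t =>
  (trace (R.spec.evolution t * R.state * R.spec.evolution (-t) * R.meas x a)).re

/-- The probability `tr(ρ 1_{[E⁺,∞)}(H))` that the state has energy above or equal to `E⁺`. -/
def highEnergyProb (R : Realization 𝓗 X A) (Eplus : ℝ) : ℝ :=
  (trace (R.state * R.spec.proj (Set.Ici Eplus))).re

end Realization

/-- The set `S(E⁺; ε)` of timelines that admit a realization under the soft energy support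
constraint: the energy is above or equal to `E⁺` with probability at most `ε`. -/
def softSupportSet (X A : Type*) [Fintype A] (Eplus ε : ℝ) : Set (X → A → ℝ → ℝ) :=
  {P | ∃ (𝓗 : Type) (_ : NormedAddCommGroup 𝓗) (_ : InnerProductSpace ℂ 𝓗) (_ : CompleteSpace 𝓗)
    (R : Realization 𝓗 X A), R.highEnergyProb Eplus ≤ ε ∧ P = R.timeline}

/-- The set `S(E⁺; ε, t)` of datasets obtained from `S(E⁺; ε)` at measurement times
`t = (t₁, …, t_N)`. -/
def softSupportDatasets (X A : Type*) [Fintype A] (Eplus ε : ℝ) {N : ℕ} (t : Fin N → ℝ) :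
    Set (X → A → Fin N → ℝ) :=
  {Q | ∃ P ∈ softSupportSet X A Eplus ε, Q = fun x a j => P x a (t j)}

/-- The timeline `P` fits the noisy dataset with measurement times `t`, probability estimates `Q`
and error bars `δ`. -/
def Fits {X A : Type*} [Fintype A] {N : ℕ} (t : Fin N → ℝ) (Q : X → A → Fin N → ℝ)
    (δ : X → Fin N → ℝ) (P : X → A → ℝ → ℝ) : Prop :=
  ∀ x j, ∑ a, |P x a (t j) - Q x a j| ≤ δ x j

/-- The dataset `P̃(0|t₁) = 1`, `P̃(0|t₂) = 0` (hence `P̃(1|t₁) = 0`, `P̃(1|t₂) = 1`), with a single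
measurement setting and two outcomes. -/
def flipDataset : Fin 1 → Fin 2 → Fin 2 → ℝ := fun _ => ![![1, 0], ![0, 1]]

/-- The dataset with three measurement times in which outcome `0` has probabilities `1, 0, 0`. -/
def extendedDataset : Fin 1 → Fin 2 → Fin 3 → ℝ := fun _ => ![![1, 0, 0], ![0, 1, 1]]

/-- The noisy dataset `(P̃, δ)` at times `0`, `Δ`, with the same error bar `δ` at both times. -/
def FitsFlip (Δ δ : ℝ) (P : Fin 1 → Fin 2 → ℝ → ℝ) : Prop :=
  Fits ![0, Δ] flipDataset (fun _ _ => δ) P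

/-- `τ_m = 2Δ + Δ / (2m + 1)`. -/
def tau (Δ : ℝ) (m : ℕ) : ℝ := 2 * Δ + Δ / (2 * (m : ℝ) + 1)

/-- The projector `|φ⟩⟨φ|` onto a unit vector `φ` of `ℂ²`. -/
def ketbra (φ : EuclideanSpace ℂ (Fin 2)) :
    EuclideanSpace ℂ (Fin 2) →L[ℂ] EuclideanSpace ℂ (Fin 2) :=
  InnerProductSpace.rankOne ℂ φ φ

/-- `|+⟩ = (|0⟩ + |1⟩)/√2`. -/
def ketPlus : EuclideanSpace ℂ (Fin 2) := !₂[((1 / √2 : ℝ) : ℂ), ((1 / √2 : ℝ) : ℂ)]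

/-- `|1⟩`. -/
def ketOne : EuclideanSpace ℂ (Fin 2) := !₂[0, 1]

/-- The Hamiltonian `H_m = ((2m+1)π/Δ) |1⟩⟨1|` on `ℂ²`, as an everywhere defined operator. -/
def qubitHam (Δ : ℝ) (m : ℕ) : EuclideanSpace ℂ (Fin 2) →ₗ.[ℂ] EuclideanSpace ℂ (Fin 2) :=
  LinearMap.toPMap
    (((((2 * (m : ℝ) + 1) * Real.pi / Δ : ℝ) : ℂ) • ketbra ketOne :
      EuclideanSpace ℂ (Fin 2) →L[ℂ] EuclideanSpace ℂ (Fin 2)) :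
      EuclideanSpace ℂ (Fin 2) →ₗ[ℂ] EuclideanSpace ℂ (Fin 2)) ⊤

end TimedMeasurement

end

open TimedMeasurement

/-!
For energies `l ≥ 0` the function `5 - cos (2 l Δ) - 4 cos (l Δ)` is at most `4 (l Δ)²`, and it
never exceeds `8`. If the energy is at least `E⁺` with probability at most `1/2`, averaging over the
energy distribution of `ρ` therefore gives
`1 - Re tr (e^{-2iHΔ} ρ) ≤ 4 Re tr (e^{-iHΔ} ρ) + 4 (E⁺ Δ)²`.
When the outcome flips between the times `0` and `Δ` up to an error `δ`, purifications of the states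
at these two times are nearly distinguished by a measurement, so that their overlap
`tr (e^{-iHΔ} ρ)` has real part at most `2 √δ`. Hence the overlap at time `2Δ` is close to one: the
state, and with it the outcome, has almost returned. The bound survives limits of datasets, so
outcome `1` at time `2Δ` stays out of the closure for small `E⁺ Δ`.

A qubit with energies `0` and `(2m+1)π/Δ` in the state `|+⟩` has high energy with probability `1/2`
and flips at `Δ`. As `τ_m` is an odd multiple of `Δ / (2m+1)`, it is also flipped at `τ_m`, although
`τ_m → 2Δ`.
-/

namespace TimedMeasurement

section InnerProductSpace

variable {E : Type*} [NormedAddCommGroup E] [InnerProductSpace ℂ E]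

theorem tendsto_inner_of_tendsto_inner_self {κ : Type*} {l : Filter κ} {S : κ → E →L[ℂ] E}
    {T : E →L[ℂ] E} (h : ∀ x, Tendsto (fun k => inner ℂ x (S k x)) l (𝓝 (inner ℂ x (T x))))
    (x y : E) : Tendsto (fun k => inner ℂ (S k y) x) l (𝓝 (inner ℂ (T y) x)) := by
  have hconj (x : E) : Tendsto (fun k => inner ℂ ((S k : E →ₗ[ℂ] E) x) x) l
      (𝓝 (inner ℂ ((T : E →ₗ[ℂ] E) x) x)) := by
    simpa [inner_conj_symm, Function.comp_def] using
      (Complex.continuous_conj.tendsto _).comp (h x)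
  have hpolarization := ((((hconj (x + y)).sub (hconj (x - y))).add
    ((hconj (x + Complex.I • y)).const_mul Complex.I)).sub
    ((hconj (x - Complex.I • y)).const_mul Complex.I)).div_const 4
  simp only [← inner_map_polarization] at hpolarization
  exact hpolarization

theorem opNorm_le_of_tendsto_inner_self {κ : Type*} {l : Filter κ} [l.NeBot]
    {S : κ → E →L[ℂ] E} {T : E →L[ℂ] E} {C : ℝ} (hS : ∀ k, ‖S k‖ ≤ C)
    (h : ∀ x, Tendsto (fun k => inner ℂ x (S k x)) l (𝓝 (inner ℂ x (T x)))) : ‖T‖ ≤ C := by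
  obtain ⟨k₀⟩ := l.nonempty_of_neBot
  refine T.opNorm_le_bound ((norm_nonneg _).trans (hS k₀)) fun x => ?_
  have hsq : ‖T x‖ * ‖T x‖ ≤ C * ‖x‖ * ‖T x‖ := by
    rw [← inner_self_eq_norm_mul_norm (𝕜 := ℂ), inner_self_re_eq_norm]
    exact le_of_tendsto' (tendsto_inner_of_tendsto_inner_self h (T x) x).norm fun k =>
      (norm_inner_le_norm _ _).trans <| by gcongr; exact (S k).le_of_opNorm_le (hS k) x
  rcases (norm_nonneg (T x)).eq_or_lt with hzero | hpos
  · exact hzero ▸ mul_nonneg ((norm_nonneg _).trans (hS k₀)) (norm_nonneg x)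
  · exact le_of_mul_le_mul_right hsq hpos

theorem eq_of_inner_self_eq {S T : E →L[ℂ] E} (h : ∀ x, inner ℂ x (S x) = inner ℂ x (T x)) :
    S = T := by
  refine ContinuousLinearMap.coe_injective ((ext_inner_map _ _).1 fun x => ?_)
  rw [← inner_conj_symm, ← inner_conj_symm (_ : E) x]
  exact congrArg _ (h x)

end InnerProductSpace

section HilbertSchmidt

variable {𝕜 E F ι κ : Type*} [RCLike 𝕜] [NormedAddCommGroup E] [InnerProductSpace 𝕜 E]
  [NormedAddCommGroup F] [InnerProductSpace 𝕜 F]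

theorem hasSum_norm_inner_sq (b : HilbertBasis ι 𝕜 E) (x : E) :
    HasSum (fun i => ‖inner 𝕜 (b i) x‖ ^ 2) (‖x‖ ^ 2) := by
  have h := RCLike.hasSum_re 𝕜 (b.hasSum_inner_mul_inner x x)
  simpa only [inner_mul_symm_re_eq_norm, norm_mul, norm_inner_symm x, ← sq,
    inner_self_eq_norm_sq] using h

theorem summable_norm_inner_sq (b : HilbertBasis ι 𝕜 E) {x : κ → E}
    (hx : Summable fun j => ‖x j‖ ^ 2) :
    Summable fun p : κ × ι => ‖inner 𝕜 (b p.2) (x p.1)‖ ^ 2 := by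
  refine (summable_prod_of_nonneg fun p => by positivity).2
    ⟨fun j => (hasSum_norm_inner_sq b (x j)).summable, ?_⟩
  simpa only [(hasSum_norm_inner_sq b _).tsum_eq] using hx

theorem summable_inner_mul_inner (b : HilbertBasis ι 𝕜 E) {x y : κ → E}
    (hx : Summable fun j => ‖x j‖ ^ 2) (hy : Summable fun j => ‖y j‖ ^ 2) :
    Summable fun p : κ × ι => inner 𝕜 (x p.1) (b p.2) * inner 𝕜 (b p.2) (y p.1) := by
  refine Summable.of_norm_bounded
    ((summable_norm_inner_sq b hx).add (summable_norm_inner_sq b hy)) fun p => ?_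
  rw [norm_mul, norm_inner_symm]
  linarith [two_mul_le_add_sq ‖inner 𝕜 (b p.2) (x p.1)‖ ‖inner 𝕜 (b p.2) (y p.1)‖,
    sq_nonneg ‖inner 𝕜 (b p.2) (x p.1)‖, sq_nonneg ‖inner 𝕜 (b p.2) (y p.1)‖]

theorem tsum_inner_apply_apply_eq_tsum_inner_adjoint_adjoint [CompleteSpace E] [CompleteSpace F]
    (b : HilbertBasis ι 𝕜 E) (c : HilbertBasis κ 𝕜 F) {S T : E →L[𝕜] F}
    (hS : Summable fun j => ‖S (b j)‖ ^ 2) (hT : Summable fun j => ‖T (b j)‖ ^ 2) :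
    ∑' j, inner 𝕜 (S (b j)) (T (b j)) = ∑' i, inner 𝕜 (T.adjoint (c i)) (S.adjoint (c i)) := by
  have hsummable : Summable (Function.uncurry fun j i =>
      inner 𝕜 (S (b j)) (c i) * inner 𝕜 (c i) (T (b j))) :=
    summable_inner_mul_inner (x := fun j => S (b j)) (y := fun j => T (b j)) c hS hT
  calc ∑' j, inner 𝕜 (S (b j)) (T (b j))
      = ∑' j, ∑' i, inner 𝕜 (S (b j)) (c i) * inner 𝕜 (c i) (T (b j)) := by
        simp only [c.tsum_inner_mul_inner]
    _ = ∑' i, ∑' j, inner 𝕜 (S (b j)) (c i) * inner 𝕜 (c i) (T (b j)) :=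
        hsummable.tsum_comm.symm
    _ = ∑' i, ∑' j, inner 𝕜 (T.adjoint (c i)) (b j) * inner 𝕜 (b j) (S.adjoint (c i)) := by
        refine tsum_congr fun i => tsum_congr fun j => ?_
        rw [T.adjoint_inner_left, S.adjoint_inner_right, mul_comm]
    _ = ∑' i, inner 𝕜 (T.adjoint (c i)) (S.adjoint (c i)) := by
        simp only [b.tsum_inner_mul_inner]

end HilbertSchmidt

namespace SpectralMeasure

variable {𝓗 : Type*} [NormedAddCommGroup 𝓗] [InnerProductSpace ℂ 𝓗] [CompleteSpace 𝓗]

theorem measureReal_univ (E : SpectralMeasure 𝓗) (ψ : 𝓗) :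
    (E.measure ψ).real Set.univ = ‖ψ‖ ^ 2 := by
  rw [E.measureReal_apply ψ MeasurableSet.univ, E.proj_univ, one_apply_eq_self]

theorem opNorm_simpleIntegral_le (E : SpectralMeasure 𝓗) {s : SimpleFunc ℝ ℂ} {C : ℝ}
    (hs : ∀ l, ‖s l‖ ≤ C) : ‖E.simpleIntegral s‖ ≤ C := by
  have hC : 0 ≤ C := (norm_nonneg _).trans (hs 0)
  refine ContinuousLinearMap.opNorm_le_bound _ hC fun ψ =>
    (sq_le_sq₀ (norm_nonneg _) (by positivity)).1 ?_
  calc ‖E.simpleIntegral s ψ‖ ^ 2 = ∫ l, ‖s l‖ ^ 2 ∂(E.measure ψ) := E.norm_simpleIntegral_sq s ψ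
    _ ≤ ∫ _, C ^ 2 ∂(E.measure ψ) :=
        integral_mono_of_nonneg (Eventually.of_forall fun l => by positivity)
          (integrable_const _) (Eventually.of_forall fun l => by dsimp only; gcongr; exact hs l)
    _ = (C * ‖ψ‖) ^ 2 := by
        rw [integral_const, E.measureReal_univ, smul_eq_mul, mul_pow, mul_comm]

theorem opNorm_le_of_inner_eq_integral (E : SpectralMeasure 𝓗) {f : ℝ → ℂ} (hf : Measurable f)
    {C : ℝ} (hC : ∀ l, ‖f l‖ ≤ C) {T : 𝓗 →L[ℂ] 𝓗}
    (hT : ∀ ψ, inner ℂ ψ (T ψ) = ∫ l, f l ∂(E.measure ψ)) : ‖T‖ ≤ C := by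
  have hzero : (0 : ℂ) ∈ Metric.closedBall 0 C :=
    Metric.mem_closedBall_self ((norm_nonneg _).trans (hC 0))
  let s : ℕ → SimpleFunc ℝ ℂ := SimpleFunc.approxOn f hf (Metric.closedBall 0 C) 0 hzero
  have hs (n : ℕ) (l : ℝ) : ‖s n l‖ ≤ C :=
    mem_closedBall_zero_iff.1 (SimpleFunc.approxOn_mem hf hzero n l)
  refine opNorm_le_of_tendsto_inner_self (l := atTop)
    (fun n => E.opNorm_simpleIntegral_le (hs n)) fun ψ => ?_
  simp only [inner_simpleIntegral, hT]
  refine tendsto_integral_of_dominated_convergence (fun _ => C)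
    (fun n => (s n).measurable.aestronglyMeasurable) (integrable_const _)
    (fun n => Eventually.of_forall (hs n)) (Eventually.of_forall fun l => ?_)
  exact SimpleFunc.tendsto_approxOn hf hzero
    (subset_closure (mem_closedBall_zero_iff.2 (hC l)))

theorem norm_evolution_le (E : SpectralMeasure 𝓗) (t : ℝ) : ‖E.evolution t‖ ≤ 1 :=
  E.opNorm_le_of_inner_eq_integral (by fun_prop) (fun l => by simp [Complex.norm_exp])
    (E.inner_evolution t)

theorem evolution_zero (E : SpectralMeasure 𝓗) : E.evolution 0 = 1 :=
  eq_of_inner_self_eq fun ψ => by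
    simp [E.inner_evolution, E.measureReal_univ, inner_self_eq_norm_sq_to_K]

theorem star_evolution (E : SpectralMeasure 𝓗) (t : ℝ) :
    star (E.evolution t) = E.evolution (-t) := by
  refine eq_of_inner_self_eq fun ψ => ?_
  rw [ContinuousLinearMap.star_eq_adjoint, ContinuousLinearMap.adjoint_inner_right,
    ← inner_conj_symm, inner_evolution, inner_evolution, ← integral_conj]
  refine integral_congr_ae (Eventually.of_forall fun l => ?_)
  simp [← Complex.exp_conj]

theorem re_inner_evolution (E : SpectralMeasure 𝓗) (t : ℝ) (ψ : 𝓗) :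
    (inner ℂ ψ (E.evolution t ψ)).re = ∫ l, Real.cos (l * t) ∂(E.measure ψ) := by
  have hint : Integrable (fun l : ℝ => Complex.exp (-Complex.I * (l : ℂ) * (t : ℂ)))
      (E.measure ψ) :=
    Integrable.of_bound (C := 1) (by fun_prop)
      (Eventually.of_forall fun l => by simp [Complex.norm_exp])
  rw [inner_evolution, ← RCLike.re_to_complex, ← integral_re hint]
  refine integral_congr_ae (Eventually.of_forall fun l => ?_)
  simp [Complex.exp_re]

theorem measure_proj (E : SpectralMeasure 𝓗) {B : Set ℝ} (hB : MeasurableSet B) (ψ : 𝓗) :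
    E.measure (E.proj B ψ) = (E.measure ψ).restrict B := by
  ext A hA
  rw [Measure.restrict_apply hA, E.measure_apply _ hA, E.measure_apply _ (hA.inter hB),
    E.proj_inter A B hA hB, mul_apply_eq_comp]

theorem IsResolutionOf.proj_mem_domain {E : SpectralMeasure 𝓗} {H : 𝓗 →ₗ.[ℂ] 𝓗}
    (hE : E.IsResolutionOf H) {B : Set ℝ} (hB : MeasurableSet B) (hbdd : Bornology.IsBounded B)
    (ψ : 𝓗) : E.proj B ψ ∈ H.domain := by
  obtain ⟨C, hC⟩ := hbdd.exists_norm_le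
  rw [hE.mem_domain_iff, E.measure_proj hB]
  refine Integrable.of_bound (C := C ^ 2) (by fun_prop) ?_
  filter_upwards [ae_restrict_mem hB] with l hl
  rw [norm_pow]
  gcongr
  exact hC l hl

theorem IsResolutionOf.setIntegral_nonneg {E : SpectralMeasure 𝓗} {H : 𝓗 →ₗ.[ℂ] 𝓗}
    (hE : E.IsResolutionOf H) (hH : ∀ ψ : H.domain, 0 ≤ (inner ℂ (ψ : 𝓗) (H ψ)).re)
    {B : Set ℝ} (hB : MeasurableSet B) (hbdd : Bornology.IsBounded B) (ψ : 𝓗) :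
    0 ≤ ∫ l in B, l ∂(E.measure ψ) := by
  have h := hH ⟨_, hE.proj_mem_domain hB hbdd ψ⟩
  rwa [hE.inner_apply, Complex.ofReal_re, E.measure_proj hB] at h

theorem IsResolutionOf.measure_Iio_eq_zero {E : SpectralMeasure 𝓗} {H : 𝓗 →ₗ.[ℂ] 𝓗}
    (hE : E.IsResolutionOf H) (hH : ∀ ψ : H.domain, 0 ≤ (inner ℂ (ψ : 𝓗) (H ψ)).re) (ψ : 𝓗) :
    E.measure ψ (Set.Iio 0) = 0 := by
  have hIco (n : ℕ) : E.measure ψ (Set.Ico (-n) 0) = 0 := by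
    have hint : IntegrableOn (fun l : ℝ => -l) (Set.Ico (-n) 0) (E.measure ψ) :=
      (continuous_neg.continuousOn.integrableOn_Icc).mono_set Set.Ico_subset_Icc_self
    have hnonneg : 0 ≤ᵐ[(E.measure ψ).restrict (Set.Ico (-(n : ℝ)) 0)] fun l : ℝ => -l := by
      filter_upwards [ae_restrict_mem measurableSet_Ico] with l hl
      exact neg_nonneg.2 hl.2.le
    have hsupport : Function.support (fun l : ℝ => -l) ∩ Set.Ico (-(n : ℝ)) 0 =
        Set.Ico (-(n : ℝ)) 0 :=
      Set.inter_eq_right.2 fun l hl => neg_ne_zero.2 hl.2.ne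
    have hle := hE.setIntegral_nonneg hH measurableSet_Ico (Metric.isBounded_Ico (-(n : ℝ)) 0) ψ
    have hiff := setIntegral_pos_iff_support_of_nonneg_ae hnonneg hint
    rw [hsupport, integral_neg] at hiff
    by_contra hne
    linarith [hiff.2 (pos_iff_ne_zero.2 hne)]
  refine measure_mono_null (fun l hl => ?_) (measure_iUnion_null hIco)
  obtain ⟨n, hn⟩ := exists_nat_ge (-l)
  exact Set.mem_iUnion.2 ⟨n, by linarith, hl⟩

end SpectralMeasure

section EnergyBound

theorem five_sub_cos_two_mul_sub_four_mul_cos_le_eight (x : ℝ) :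
    5 - Real.cos (2 * x) - 4 * Real.cos x ≤ 8 := by
  rw [Real.cos_two_mul]
  linarith [sq_nonneg (Real.cos x + 1)]

theorem five_sub_cos_two_mul_sub_four_mul_cos_le_sq (x : ℝ) :
    5 - Real.cos (2 * x) - 4 * Real.cos x ≤ 4 * x ^ 2 := by
  calc 5 - Real.cos (2 * x) - 4 * Real.cos x
      = 8 * (1 - Real.cos x) - 2 * (1 - Real.cos x) ^ 2 := by rw [Real.cos_two_mul]; ring
    _ ≤ 8 * (1 - Real.cos x) := by linarith [sq_nonneg (1 - Real.cos x)]
    _ ≤ 4 * x ^ 2 := by linarith [Real.one_sub_sq_div_two_le_cos (x := x)]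

theorem five_sub_cos_sub_four_mul_cos_le_indicator {l : ℝ} (hl : 0 ≤ l) (Eplus Δ : ℝ) :
    5 - Real.cos (l * (2 * Δ)) - 4 * Real.cos (l * Δ)
      ≤ 4 * (Eplus * Δ) ^ 2 + (Set.Ici Eplus).indicator (fun _ => 8) l := by
  rw [mul_left_comm]
  by_cases hmem : l ∈ Set.Ici Eplus
  · rw [Set.indicator_of_mem hmem]
    linarith [five_sub_cos_two_mul_sub_four_mul_cos_le_eight (l * Δ), sq_nonneg (Eplus * Δ)]
  · rw [Set.indicator_of_notMem hmem, add_zero]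
    calc 5 - Real.cos (2 * (l * Δ)) - 4 * Real.cos (l * Δ) ≤ 4 * (l * Δ) ^ 2 :=
          five_sub_cos_two_mul_sub_four_mul_cos_le_sq _
      _ ≤ 4 * (Eplus * Δ) ^ 2 := by
          rw [mul_pow, mul_pow]
          gcongr
          exact (not_le.1 hmem).le

variable {𝓗 : Type*} [NormedAddCommGroup 𝓗] [InnerProductSpace ℂ 𝓗] [CompleteSpace 𝓗]

theorem SpectralMeasure.five_mul_sq_norm_sub_re_inner_evolution_le (E : SpectralMeasure 𝓗)
    {ψ : 𝓗} (hψ : E.measure ψ (Set.Iio 0) = 0) (Eplus Δ : ℝ) :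
    5 * ‖ψ‖ ^ 2 - (inner ℂ ψ (E.evolution (2 * Δ) ψ)).re - 4 * (inner ℂ ψ (E.evolution Δ ψ)).re
      ≤ 4 * (Eplus * Δ) ^ 2 * ‖ψ‖ ^ 2 + 8 * ‖E.proj (Set.Ici Eplus) ψ‖ ^ 2 := by
  have hcos (t : ℝ) : Integrable (fun l => Real.cos (l * t)) (E.measure ψ) :=
    Integrable.of_bound (C := 1) (by fun_prop)
      (Eventually.of_forall fun l => Real.abs_cos_le_one _)
  have hindicator : Integrable ((Set.Ici Eplus).indicator fun _ => (8 : ℝ)) (E.measure ψ) :=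
    (integrable_const _).indicator measurableSet_Ici
  have hnonneg : ∀ᵐ l ∂(E.measure ψ), 0 ≤ l :=
    (measure_eq_zero_iff_ae_notMem.1 hψ).mono fun l hl => not_lt.1 hl
  have hmono := integral_mono_ae
    (((integrable_const 5).sub (hcos (2 * Δ))).sub ((hcos Δ).const_mul 4))
    ((integrable_const (4 * (Eplus * Δ) ^ 2)).add hindicator)
    (hnonneg.mono fun l hl => five_sub_cos_sub_four_mul_cos_le_indicator hl Eplus Δ)
  rwa [integral_sub' ((integrable_const 5).sub (hcos (2 * Δ))) ((hcos Δ).const_mul 4),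
    integral_sub' (integrable_const 5) (hcos (2 * Δ)),
    integral_add' (integrable_const _) hindicator, integral_const_mul,
    integral_indicator_const _ measurableSet_Ici, integral_const,
    integral_const, ← E.re_inner_evolution, ← E.re_inner_evolution, E.measureReal_univ,
    E.measureReal_apply ψ measurableSet_Ici, smul_eq_mul, smul_eq_mul, smul_eq_mul,
    mul_comm _ (5 : ℝ), mul_comm _ (8 : ℝ), mul_comm (‖ψ‖ ^ 2) (4 * _)] at hmono

end EnergyBound

section GNSVector

variable {𝓗 : Type*} [NormedAddCommGroup 𝓗] [InnerProductSpace ℂ 𝓗] [CompleteSpace 𝓗]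
  {ρ : 𝓗 →L[ℂ] 𝓗}

theorem isSelfAdjoint_sqrt (T : 𝓗 →L[ℂ] 𝓗) : IsSelfAdjoint (CFC.sqrt T) :=
  IsSelfAdjoint.of_nonneg (CFC.sqrt_nonneg T)

theorem sqrt_mul_sqrt_of_isPositive {T : 𝓗 →L[ℂ] 𝓗} (hT : T.IsPositive) :
    CFC.sqrt T * CFC.sqrt T = T :=
  CFC.sqrt_mul_sqrt_self T ((ContinuousLinearMap.nonneg_iff_isPositive T).2 hT)

theorem inner_sqrt_self {T : 𝓗 →L[ℂ] 𝓗} (hT : T.IsPositive) (x : 𝓗) :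
    inner ℂ x (T x) = ((‖CFC.sqrt T x‖ ^ 2 : ℝ) : ℂ) := by
  have hadjoint : (CFC.sqrt T).adjoint = CFC.sqrt T := isSelfAdjoint_sqrt T
  conv_lhs => rw [← sqrt_mul_sqrt_of_isPositive hT, mul_apply_eq_comp]
  rw [← ContinuousLinearMap.adjoint_inner_left, hadjoint, inner_self_eq_norm_sq_to_K]
  norm_cast

namespace IsDensityOperator

theorem hasSum_norm_sqrt_sq (hρ : IsDensityOperator ρ) :
    HasSum (fun j => ‖CFC.sqrt ρ (basis 𝓗 j)‖ ^ 2) 1 := by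
  rw [← Complex.hasSum_ofReal, Complex.ofReal_one]
  simpa only [inner_sqrt_self hρ.isPositive] using hρ.hasSum_one

theorem memℓp_apply_sqrt (hρ : IsDensityOperator ρ) (B : 𝓗 →L[ℂ] 𝓗) :
    Memℓp (fun j => B (CFC.sqrt ρ (basis 𝓗 j))) 2 := by
  have hsqrt : Memℓp (fun j => CFC.sqrt ρ (basis 𝓗 j)) 2 :=
    memℓp_gen (by simpa using hρ.hasSum_norm_sqrt_sq.summable)
  refine (hsqrt.norm.const_mul ‖B‖).mono fun j => ?_
  simpa using B.le_opNorm (CFC.sqrt ρ (basis 𝓗 j))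

/-- The vector representing the operator `B` in the GNS representation of the state `ρ`. It is
realized as the Hilbert–Schmidt operator `B √ρ`, which is encoded by its values on the basis, so
that the Hilbert–Schmidt inner product becomes that of an `ℓ²` space. -/
noncomputable def gnsVector (hρ : IsDensityOperator ρ) :
    (𝓗 →L[ℂ] 𝓗) →ₗ[ℂ] lp (fun _ : basisSet 𝓗 => 𝓗) 2 where
  toFun B := ⟨fun j => B (CFC.sqrt ρ (basis 𝓗 j)), hρ.memℓp_apply_sqrt B⟩
  map_add' _ _ := rfl
  map_smul' _ _ := rfl

theorem gnsVector_apply (hρ : IsDensityOperator ρ) (B : 𝓗 →L[ℂ] 𝓗) (j : basisSet 𝓗) :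
    hρ.gnsVector B j = B (CFC.sqrt ρ (basis 𝓗 j)) :=
  rfl

theorem hasSum_norm_gnsVector_sq (hρ : IsDensityOperator ρ) (B : 𝓗 →L[ℂ] 𝓗) :
    HasSum (fun j => ‖B (CFC.sqrt ρ (basis 𝓗 j))‖ ^ 2) (‖hρ.gnsVector B‖ ^ 2) := by
  simpa [gnsVector_apply] using lp.hasSum_norm (by simp) (hρ.gnsVector B)

theorem inner_gnsVector (hρ : IsDensityOperator ρ) (B C : 𝓗 →L[ℂ] 𝓗) :
    inner ℂ (hρ.gnsVector B) (hρ.gnsVector C) = trace (C * ρ * star B) := by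
  calc inner ℂ (hρ.gnsVector B) (hρ.gnsVector C)
      = ∑' j, inner ℂ ((B * CFC.sqrt ρ) (basis 𝓗 j)) ((C * CFC.sqrt ρ) (basis 𝓗 j)) :=
        lp.inner_eq_tsum _ _
    _ = ∑' i, inner ℂ ((C * CFC.sqrt ρ).adjoint (basis 𝓗 i))
          ((B * CFC.sqrt ρ).adjoint (basis 𝓗 i)) :=
        tsum_inner_apply_apply_eq_tsum_inner_adjoint_adjoint (basis 𝓗) (basis 𝓗)
          (hρ.hasSum_norm_gnsVector_sq B).summable (hρ.hasSum_norm_gnsVector_sq C).summable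
    _ = trace (C * ρ * star B) := by
        refine tsum_congr fun i => ?_
        rw [ContinuousLinearMap.adjoint_inner_left, ← mul_apply_eq_comp,
          ← ContinuousLinearMap.star_eq_adjoint, star_mul, (isSelfAdjoint_sqrt ρ).star_eq,
          mul_assoc, ← mul_assoc (CFC.sqrt ρ), sqrt_mul_sqrt_of_isPositive hρ.isPositive,
          mul_assoc]

theorem norm_gnsVector_one (hρ : IsDensityOperator ρ) : ‖hρ.gnsVector 1‖ = 1 := by
  rw [← sq_eq_sq₀ (norm_nonneg _) zero_le_one, one_pow]
  exact (hρ.hasSum_norm_gnsVector_sq 1).unique hρ.hasSum_norm_sqrt_sq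

theorem norm_gnsVector_mul_le (hρ : IsDensityOperator ρ) (B C : 𝓗 →L[ℂ] 𝓗) :
    ‖hρ.gnsVector (B * C)‖ ≤ ‖B‖ * ‖hρ.gnsVector C‖ := by
  rw [← norm_norm B, ← norm_smul]
  refine lp.norm_mono (by simp) fun j => ?_
  rw [lp.coeFn_smul, Pi.smul_apply, norm_smul, norm_norm]
  exact B.le_opNorm _

theorem inner_gnsVector_mul_left (hρ : IsDensityOperator ρ) (B C D : 𝓗 →L[ℂ] 𝓗) :
    inner ℂ (hρ.gnsVector (B * C)) (hρ.gnsVector D)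
      = inner ℂ (hρ.gnsVector C) (hρ.gnsVector (star B * D)) := by
  simp only [lp.inner_eq_tsum, gnsVector_apply, mul_apply_eq_comp,
    ContinuousLinearMap.star_eq_adjoint, ContinuousLinearMap.adjoint_inner_right]

end IsDensityOperator

end GNSVector

section Purification

variable {𝓗 : Type*} [NormedAddCommGroup 𝓗] [InnerProductSpace ℂ 𝓗] [CompleteSpace 𝓗]
  {X A : Type*} [Fintype A]

theorem IsDensityOperator.inner_gnsVector_sqrt_mul {ρ : 𝓗 →L[ℂ] 𝓗} (hρ : IsDensityOperator ρ)
    {T : 𝓗 →L[ℂ] 𝓗} (hT : T.IsPositive) (B C : 𝓗 →L[ℂ] 𝓗) :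
    inner ℂ (hρ.gnsVector (CFC.sqrt T * B)) (hρ.gnsVector (CFC.sqrt T * C))
      = inner ℂ (hρ.gnsVector (T * B)) (hρ.gnsVector C) := by
  conv_rhs => rw [← sqrt_mul_sqrt_of_isPositive hT, mul_assoc, hρ.inner_gnsVector_mul_left,
    (isSelfAdjoint_sqrt T).star_eq]

theorem IsDensityOperator.sq_norm_gnsVector_proj {ρ : 𝓗 →L[ℂ] 𝓗} (hρ : IsDensityOperator ρ)
    {Q : 𝓗 →L[ℂ] 𝓗} (hQ : IsStarProjection Q) : ‖hρ.gnsVector Q‖ ^ 2 = (trace (ρ * Q)).re := by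
  rw [← inner_self_eq_norm_sq (𝕜 := ℂ), RCLike.re_to_complex]
  calc (inner ℂ (hρ.gnsVector Q) (hρ.gnsVector Q)).re
      = (inner ℂ (hρ.gnsVector (Q * Q)) (hρ.gnsVector 1)).re := by
        rw [hρ.inner_gnsVector_mul_left, hQ.isSelfAdjoint.star_eq, mul_one]
    _ = (trace (ρ * Q)).re := by
        rw [hQ.isIdempotentElem.eq, hρ.inner_gnsVector, one_mul, hQ.isSelfAdjoint.star_eq]

namespace Realization

/-- The purification of the evolved state `e^{-iHt} ρ e^{iHt}` obtained by letting `e^{-iHt}` act on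
a purification of `ρ`, encoded as a GNS vector of `ρ`. -/
noncomputable def purification (R : Realization 𝓗 X A) (t : ℝ) : lp (fun _ : basisSet 𝓗 => 𝓗) 2 :=
  R.isDensityOperator_state.gnsVector (R.spec.evolution t)

/-- The unnormalized post-measurement vector of outcome `a` of the measurement `x` at time `t`: the
square root of `M_{a|x}` applied to `R.purification t`. Its squared norm is `P(a|x,t)`. -/
noncomputable def outcomeVector (R : Realization 𝓗 X A) (x : X) (a : A) (t : ℝ) :
    lp (fun _ : basisSet 𝓗 => 𝓗) 2 :=
  R.isDensityOperator_state.gnsVector (CFC.sqrt (R.meas x a) * R.spec.evolution t)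

theorem norm_purification_le_one (R : Realization 𝓗 X A) (t : ℝ) : ‖R.purification t‖ ≤ 1 := by
  have h := R.isDensityOperator_state.norm_gnsVector_mul_le (R.spec.evolution t) 1
  rw [mul_one, IsDensityOperator.norm_gnsVector_one, mul_one] at h
  exact h.trans (R.spec.norm_evolution_le t)

theorem sum_inner_outcomeVector (R : Realization 𝓗 X A) (x : X) (s t : ℝ) :
    ∑ a, inner ℂ (R.outcomeVector x a s) (R.outcomeVector x a t)
      = inner ℂ (R.purification s) (R.purification t) := by
  simp only [outcomeVector, purification,
    IsDensityOperator.inner_gnsVector_sqrt_mul _ (R.isPositive_meas x _)]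
  rw [← sum_inner, ← map_sum, ← Finset.sum_mul, R.sum_meas, one_mul]

theorem sum_sq_norm_outcomeVector_sub (R : Realization 𝓗 X A) (x : X) (s t : ℝ) :
    ∑ a, ‖R.outcomeVector x a s - R.outcomeVector x a t‖ ^ 2
      = ‖R.purification s - R.purification t‖ ^ 2 := by
  simp only [@norm_sub_sq ℂ, ← inner_self_eq_norm_sq (𝕜 := ℂ)]
  rw [Finset.sum_add_distrib, Finset.sum_sub_distrib, ← Finset.mul_sum]
  simp only [← map_sum, sum_inner_outcomeVector]

theorem timeline_eq_sq_norm_outcomeVector (R : Realization 𝓗 X A) (x : X) (a : A) (t : ℝ) :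
    R.timeline x a t = ‖R.outcomeVector x a t‖ ^ 2 := by
  rw [← inner_self_eq_norm_sq (𝕜 := ℂ), RCLike.re_to_complex, outcomeVector,
    IsDensityOperator.inner_gnsVector_sqrt_mul _ (R.isPositive_meas x a),
    IsDensityOperator.inner_gnsVector, star_mul, (R.isPositive_meas x a).isSelfAdjoint.star_eq,
    R.spec.star_evolution, ← mul_assoc, timeline]

theorem sqrt_timeline (R : Realization 𝓗 X A) (x : X) (a : A) (t : ℝ) :
    √(R.timeline x a t) = ‖R.outcomeVector x a t‖ := by
  rw [timeline_eq_sq_norm_outcomeVector, Real.sqrt_sq (norm_nonneg _)]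

theorem timeline_nonneg (R : Realization 𝓗 X A) (x : X) (a : A) (t : ℝ) :
    0 ≤ R.timeline x a t := by
  rw [timeline_eq_sq_norm_outcomeVector]
  positivity

theorem timeline_le_one (R : Realization 𝓗 X A) (x : X) (a : A) (t : ℝ) :
    R.timeline x a t ≤ 1 := by
  have hsum : ∑ b, ‖R.outcomeVector x b t‖ ^ 2 = ‖R.purification t‖ ^ 2 := by
    simp only [← inner_self_eq_norm_sq (𝕜 := ℂ), ← map_sum, sum_inner_outcomeVector]
  rw [timeline_eq_sq_norm_outcomeVector]
  calc ‖R.outcomeVector x a t‖ ^ 2 ≤ ∑ b, ‖R.outcomeVector x b t‖ ^ 2 :=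
        Finset.single_le_sum (f := fun b => ‖R.outcomeVector x b t‖ ^ 2)
          (fun b _ => by positivity) (Finset.mem_univ a)
    _ = ‖R.purification t‖ ^ 2 := hsum
    _ ≤ 1 := pow_le_one₀ (norm_nonneg _) (R.norm_purification_le_one t)

theorem re_inner_purification_le (R : Realization 𝓗 X A) (x : X) (s t : ℝ) :
    (inner ℂ (R.purification s) (R.purification t)).re
      ≤ ∑ a, √(R.timeline x a s) * √(R.timeline x a t) := by
  rw [← R.sum_inner_outcomeVector x, Complex.re_sum]
  refine Finset.sum_le_sum fun a _ => ?_
  rw [sqrt_timeline, sqrt_timeline]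
  exact re_inner_le_norm (𝕜 := ℂ) _ _

theorem sqrt_timeline_sub_sqrt_timeline_le (R : Realization 𝓗 X A) (x : X) (a : A) (s t : ℝ) :
    √(R.timeline x a s) - √(R.timeline x a t) ≤ ‖R.purification s - R.purification t‖ := by
  rw [sqrt_timeline, sqrt_timeline]
  refine (norm_sub_norm_le _ _).trans ((sq_le_sq₀ (norm_nonneg _) (norm_nonneg _)).1 ?_)
  rw [← R.sum_sq_norm_outcomeVector_sub x]
  exact Finset.single_le_sum
    (f := fun b => ‖R.outcomeVector x b s - R.outcomeVector x b t‖ ^ 2)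
    (fun b _ => by positivity) (Finset.mem_univ a)

theorem timeline_sub_timeline_le (R : Realization 𝓗 X A) (x : X) (a : A) (s t : ℝ) :
    R.timeline x a s - R.timeline x a t ≤ 2 * ‖R.purification s - R.purification t‖ := by
  have hs : √(R.timeline x a s) ≤ 1 := Real.sqrt_le_one.2 (R.timeline_le_one x a s)
  have ht : √(R.timeline x a t) ≤ 1 := Real.sqrt_le_one.2 (R.timeline_le_one x a t)
  calc R.timeline x a s - R.timeline x a t
      = (√(R.timeline x a s) + √(R.timeline x a t))
          * (√(R.timeline x a s) - √(R.timeline x a t)) := by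
        rw [← sq_sub_sq, Real.sq_sqrt (R.timeline_nonneg x a s),
          Real.sq_sqrt (R.timeline_nonneg x a t)]
    _ ≤ (√(R.timeline x a s) + √(R.timeline x a t))
          * ‖R.purification s - R.purification t‖ := by
        gcongr
        exact R.sqrt_timeline_sub_sqrt_timeline_le x a s t
    _ ≤ 2 * ‖R.purification s - R.purification t‖ := by
        gcongr
        linarith

theorem sq_norm_purification_sub_le (R : Realization 𝓗 X A) (s t : ℝ) :
    ‖R.purification s - R.purification t‖ ^ 2
      ≤ 2 * (1 - (inner ℂ (R.purification s) (R.purification t)).re) := by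
  have hs := pow_le_one₀ (n := 2) (norm_nonneg _) (R.norm_purification_le_one s)
  have ht := pow_le_one₀ (n := 2) (norm_nonneg _) (R.norm_purification_le_one t)
  rw [@norm_sub_sq ℂ, RCLike.re_to_complex]
  linarith

theorem hasSum_re_inner_purification_zero (R : Realization 𝓗 X A) (t : ℝ) :
    HasSum (fun j => (inner ℂ (CFC.sqrt R.state (basis 𝓗 j))
        (R.spec.evolution t (CFC.sqrt R.state (basis 𝓗 j)))).re)
      (inner ℂ (R.purification 0) (R.purification t)).re := by
  have h := Complex.hasSum_re (lp.hasSum_inner (𝕜 := ℂ) (R.purification 0) (R.purification t))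
  simpa only [purification, IsDensityOperator.gnsVector_apply, R.spec.evolution_zero,
    one_apply_eq_self] using h

theorem five_sub_re_inner_purification_le (R : Realization 𝓗 X A) (Eplus Δ : ℝ) :
    5 - (inner ℂ (R.purification 0) (R.purification (2 * Δ))).re
        - 4 * (inner ℂ (R.purification 0) (R.purification Δ)).re
      ≤ 4 * (Eplus * Δ) ^ 2 + 8 * R.highEnergyProb Eplus := by
  have hnorm := R.isDensityOperator_state.hasSum_norm_sqrt_sq
  have henergy := R.isDensityOperator_state.hasSum_norm_gnsVector_sq (R.spec.proj (Set.Ici Eplus))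
  rw [IsDensityOperator.sq_norm_gnsVector_proj _
    (R.spec.isStarProjection _ measurableSet_Ici)] at henergy
  have hle := hasSum_le
    (fun j => R.spec.five_mul_sq_norm_sub_re_inner_evolution_le
      (R.isResolutionOf_spec.measure_Iio_eq_zero R.ham_nonneg
        (CFC.sqrt R.state (basis 𝓗 j))) Eplus Δ)
    (((hnorm.mul_left 5).sub (R.hasSum_re_inner_purification_zero (2 * Δ))).sub
      ((R.hasSum_re_inner_purification_zero Δ).mul_left 4))
    ((hnorm.mul_left (4 * (Eplus * Δ) ^ 2)).add (henergy.mul_left 8))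
  simpa only [mul_one, highEnergyProb] using hle

end Realization

end Purification

section Flip

variable {𝓗 : Type*} [NormedAddCommGroup 𝓗] [InnerProductSpace ℂ 𝓗] [CompleteSpace 𝓗]
  {P : Fin 1 → Fin 2 → ℝ → ℝ} {Eplus Δ δ : ℝ}

theorem fitsFlip_iff : FitsFlip Δ δ P ↔
    |P 0 0 0 - 1| + |P 0 1 0| ≤ δ ∧ |P 0 0 Δ| + |P 0 1 Δ - 1| ≤ δ := by
  simp [FitsFlip, Fits, flipDataset, Fin.forall_fin_two, Fin.sum_univ_two]

theorem Realization.re_inner_purification_le_of_fitsFlip {R : Realization 𝓗 (Fin 1) (Fin 2)}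
    (h : FitsFlip Δ δ R.timeline) :
    (inner ℂ (R.purification 0) (R.purification Δ)).re ≤ 2 * √δ := by
  obtain ⟨hzero, hΔ⟩ := fitsFlip_iff.1 h
  have hdistinct : R.timeline 0 1 0 ≤ δ := by
    linarith [le_abs_self (R.timeline 0 1 0), abs_nonneg (R.timeline 0 0 0 - 1)]
  have hflipped : R.timeline 0 0 Δ ≤ δ := by
    linarith [le_abs_self (R.timeline 0 0 Δ), abs_nonneg (R.timeline 0 1 Δ - 1)]
  calc (inner ℂ (R.purification 0) (R.purification Δ)).re
      ≤ √(R.timeline 0 0 0) * √(R.timeline 0 0 Δ)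
          + √(R.timeline 0 1 0) * √(R.timeline 0 1 Δ) := by
        simpa only [Fin.sum_univ_two] using R.re_inner_purification_le 0 0 Δ
    _ ≤ 1 * √δ + √δ * 1 := by
        gcongr
        · exact Real.sqrt_le_one.2 (R.timeline_le_one 0 0 0)
        · exact Real.sqrt_le_one.2 (R.timeline_le_one 0 1 Δ)
    _ = 2 * √δ := by ring

theorem Realization.one_sub_timeline_two_mul_le {R : Realization 𝓗 (Fin 1) (Fin 2)}
    (hR : R.highEnergyProb Eplus ≤ 1 / 2) (h : FitsFlip Δ δ R.timeline) :
    1 - R.timeline 0 0 (2 * Δ) ≤ δ + 2 * √(16 * √δ + 8 * (Eplus * Δ) ^ 2) := by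
  have hoverlap := R.five_sub_re_inner_purification_le Eplus Δ
  have hsmall := re_inner_purification_le_of_fitsFlip h
  have hreturn : ‖R.purification 0 - R.purification (2 * Δ)‖
      ≤ √(16 * √δ + 8 * (Eplus * Δ) ^ 2) :=
    Real.le_sqrt_of_sq_le (by linarith [R.sq_norm_purification_sub_le 0 (2 * Δ)])
  have hstart : 1 - R.timeline 0 0 0 ≤ δ := by
    linarith [(fitsFlip_iff.1 h).1, neg_abs_le (R.timeline 0 0 0 - 1),
      abs_nonneg (R.timeline 0 1 0)]
  linarith [R.timeline_sub_timeline_le 0 0 0 (2 * Δ)]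

theorem one_sub_apply_two_mul_le_sqrt (hδ : 0 ≤ δ)
    (hP : P ∈ softSupportSet (Fin 1) (Fin 2) Eplus (1 / 2)) (h : FitsFlip Δ δ P) :
    1 - P 0 0 (2 * Δ) ≤ √(130 * √δ + 64 * (Eplus * Δ) ^ 2) := by
  obtain ⟨𝓗, _, _, _, R, hR, rfl⟩ := hP
  rcases le_total δ 1 with hδ1 | hδ1
  · have hsq : √(16 * √δ + 8 * (Eplus * Δ) ^ 2) ^ 2 = 16 * √δ + 8 * (Eplus * Δ) ^ 2 :=
      Real.sq_sqrt (by positivity)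
    have hδsqrt : δ ^ 2 ≤ √δ := Real.le_sqrt_of_sq_le <| by
      rw [← pow_mul]
      exact pow_le_of_le_one hδ hδ1 (by norm_num)
    refine (R.one_sub_timeline_two_mul_le hR h).trans (Real.le_sqrt_of_sq_le ?_)
    linarith [sq_nonneg (δ - 2 * √(16 * √δ + 8 * (Eplus * Δ) ^ 2))]
  · have hone : (1 : ℝ) ≤ √δ := Real.one_le_sqrt.2 hδ1
    refine (sub_le_self 1 (R.timeline_nonneg 0 0 _)).trans (Real.one_le_sqrt.2 ?_)
    linarith [sq_nonneg (Eplus * Δ)]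

end Flip

section Diagonal

variable {ι : Type*} [Fintype ι] [DecidableEq ι]

/-- The diagonal operator on `ℂ^ι` with entries `c`. -/
noncomputable def diagOp (c : ι → ℂ) : EuclideanSpace ℂ ι →L[ℂ] EuclideanSpace ℂ ι :=
  Matrix.toEuclideanCLM (n := ι) (𝕜 := ℂ) (Matrix.diagonal c)

theorem diagOp_apply (c : ι → ℂ) (ψ : EuclideanSpace ℂ ι) (i : ι) :
    diagOp c ψ i = c i * ψ i := by
  simp [diagOp, Matrix.mulVec_diagonal]

theorem diagOp_mul (c d : ι → ℂ) : diagOp c * diagOp d = diagOp (c * d) := by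
  ext ψ i
  simp only [mul_apply_eq_comp, diagOp_apply, Pi.mul_apply, mul_assoc]

theorem star_diagOp (c : ι → ℂ) : star (diagOp c) = diagOp (star c) := by
  rw [diagOp, ← map_star, Matrix.star_eq_conjTranspose, Matrix.diagonal_conjTranspose, diagOp]

theorem diagOp_one : diagOp (1 : ι → ℂ) = 1 := by
  ext ψ i
  simp only [diagOp_apply, Pi.one_apply, one_mul, one_apply_eq_self]

theorem sq_norm_diagOp_apply (c : ι → ℂ) (ψ : EuclideanSpace ℂ ι) :
    ‖diagOp c ψ‖ ^ 2 = ∑ i, ‖c i‖ ^ 2 * ‖ψ i‖ ^ 2 := by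
  simp only [EuclideanSpace.norm_sq_eq, diagOp_apply, norm_mul, mul_pow]

theorem inner_diagOp_apply (c : ι → ℂ) (ψ : EuclideanSpace ℂ ι) :
    inner ℂ ψ (diagOp c ψ) = ∑ i, ‖ψ i‖ ^ 2 • c i := by
  rw [PiLp.inner_apply]
  refine Finset.sum_congr rfl fun i _ => ?_
  rw [diagOp_apply, RCLike.inner_apply, mul_assoc, Complex.mul_conj, Complex.normSq_eq_norm_sq,
    mul_comm, Complex.real_smul]

theorem hasSum_diagOp {κ : Type*} {c : κ → ι → ℂ} {d : ι → ℂ} (h : HasSum c d)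
    (ψ : EuclideanSpace ℂ ι) : HasSum (fun k => diagOp (c k) ψ) (diagOp d ψ) := by
  let diagOpApply : (ι → ℂ) →ₗ[ℂ] EuclideanSpace ℂ ι :=
    { toFun := fun c => diagOp c ψ
      map_add' := fun c d => by ext i; simp [diagOp_apply, add_mul]
      map_smul' := fun a c => by ext i; simp [diagOp_apply, mul_assoc] }
  exact h.mapL diagOpApply.toContinuousLinearMap

theorem hasSum_indicator_one_iUnion {α κ M : Type*} [AddCommMonoid M] [One M]
    [TopologicalSpace M] {A : κ → Set α} (hA : Pairwise (Function.onFun Disjoint A)) (x : α) :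
    HasSum (fun n => (A n).indicator (1 : α → M) x) ((⋃ n, A n).indicator 1 x) := by
  by_cases hx : x ∈ ⋃ n, A n
  · obtain ⟨k, hk⟩ := Set.mem_iUnion.1 hx
    rw [Set.indicator_of_mem hx, ← Set.indicator_of_mem hk (1 : α → M)]
    exact hasSum_single k fun n hn =>
      Set.indicator_of_notMem (fun h => Set.disjoint_left.1 (hA hn) h hk) _
  · rw [Set.indicator_of_notMem hx]
    simpa only [Set.indicator_of_notMem fun h => hx (Set.mem_iUnion.2 ⟨_, h⟩)]
      using hasSum_zero (α := M)

theorem isStarProjection_diagOp_indicator_one (A : Set ℝ) (h : ι → ℝ) :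
    IsStarProjection (diagOp fun i => A.indicator (1 : ℝ → ℂ) (h i)) where
  isIdempotentElem := by
    rw [IsIdempotentElem, diagOp_mul]
    congr 1
    ext i
    by_cases hi : h i ∈ A <;> simp [hi]
  isSelfAdjoint := by
    rw [IsSelfAdjoint, star_diagOp]
    congr 1
    ext i
    by_cases hi : h i ∈ A <;> simp [hi]

/-- The spectral measure of the diagonal operator on `ℂ^ι` with real entries `h`. -/
noncomputable def diagSpec (h : ι → ℝ) : SpectralMeasure (EuclideanSpace ℂ ι) where
  proj A := diagOp fun i => A.indicator 1 (h i)
  isStarProjection A _ := isStarProjection_diagOp_indicator_one A h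
  proj_univ := by
    simp only [Set.indicator_univ]
    exact diagOp_one
  proj_inter A B _ _ := by
    rw [diagOp_mul, Set.inter_indicator_one]
    rfl
  hasSum_iUnion A _ hd ψ :=
    hasSum_diagOp (Pi.hasSum.2 fun i => hasSum_indicator_one_iUnion hd (h i)) ψ

theorem measure_diagSpec (h : ι → ℝ) (ψ : EuclideanSpace ℂ ι) :
    (diagSpec h).measure ψ = ∑ i, ENNReal.ofReal (‖ψ i‖ ^ 2) • Measure.dirac (h i) := by
  ext A hA
  rw [SpectralMeasure.measure_apply _ _ hA, Measure.finsetSum_apply, diagSpec,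
    sq_norm_diagOp_apply, ENNReal.ofReal_sum_of_nonneg fun i _ => by positivity]
  refine Finset.sum_congr rfl fun i _ => ?_
  by_cases hi : h i ∈ A <;> simp [hi, hA]

theorem integrable_measure_diagSpec {F : Type*} [NormedAddCommGroup F] (h : ι → ℝ)
    (ψ : EuclideanSpace ℂ ι) (f : ℝ → F) : Integrable f ((diagSpec h).measure ψ) := by
  rw [measure_diagSpec, integrable_finsetSum_measure]
  exact fun i _ => (integrable_dirac (by simp)).smul_measure ENNReal.ofReal_ne_top

theorem integral_measure_diagSpec {F : Type*} [NormedAddCommGroup F] [NormedSpace ℝ F]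
    [CompleteSpace F] (h : ι → ℝ) (ψ : EuclideanSpace ℂ ι) (f : ℝ → F) :
    ∫ l, f l ∂((diagSpec h).measure ψ) = ∑ i, ‖ψ i‖ ^ 2 • f (h i) := by
  rw [measure_diagSpec, integral_finsetSum_measure
    fun i _ => (integrable_dirac (by simp)).smul_measure ENNReal.ofReal_ne_top]
  refine Finset.sum_congr rfl fun i _ => ?_
  rw [integral_smul_measure, integral_dirac, ENNReal.toReal_ofReal (by positivity)]

theorem evolution_diagSpec (h : ι → ℝ) (t : ℝ) :
    (diagSpec h).evolution t
      = diagOp fun i => Complex.exp (-Complex.I * (h i : ℂ) * (t : ℂ)) :=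
  eq_of_inner_self_eq fun ψ => by
    rw [SpectralMeasure.inner_evolution, integral_measure_diagSpec, inner_diagOp_apply]

theorem norm_evolution_diagSpec_apply (h : ι → ℝ) (t : ℝ) (ψ : EuclideanSpace ℂ ι) :
    ‖(diagSpec h).evolution t ψ‖ = ‖ψ‖ := by
  rw [← sq_eq_sq₀ (norm_nonneg _) (norm_nonneg _), evolution_diagSpec, sq_norm_diagOp_apply,
    EuclideanSpace.norm_sq_eq]
  simp [Complex.norm_exp]

theorem isResolutionOf_diagSpec (h : ι → ℝ) :
    (diagSpec h).IsResolutionOf (LinearMap.toPMap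
      (diagOp fun i => (h i : ℂ) : EuclideanSpace ℂ ι →ₗ[ℂ] EuclideanSpace ℂ ι) ⊤) where
  mem_domain_iff ψ :=
    ⟨fun _ => integrable_measure_diagSpec h ψ _, fun _ => Submodule.mem_top⟩
  inner_apply ψ := by
    change inner ℂ (ψ : EuclideanSpace ℂ ι) (diagOp (fun i => (h i : ℂ)) ψ) = _
    rw [integral_measure_diagSpec, inner_diagOp_apply]
    simp

theorem isSelfAdjoint_toPMap_diagOp (h : ι → ℝ) :
    IsSelfAdjoint (LinearMap.toPMap
      (diagOp fun i => (h i : ℂ) : EuclideanSpace ℂ ι →ₗ[ℂ] EuclideanSpace ℂ ι) ⊤) := by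
  have hstar : star (diagOp fun i => (h i : ℂ)) = diagOp fun i => (h i : ℂ) := by
    rw [star_diagOp]
    congr 1
    ext i
    exact Complex.conj_ofReal (h i)
  rw [LinearPMap.isSelfAdjoint_def,
    ContinuousLinearMap.toPMap_adjoint_eq_adjoint_toPMap_of_dense _ (by simp),
    ← ContinuousLinearMap.star_eq_adjoint, hstar]

end Diagonal

section PureState

variable {𝓗 : Type*} [NormedAddCommGroup 𝓗] [InnerProductSpace ℂ 𝓗] [CompleteSpace 𝓗] {φ : 𝓗}

theorem isDensityOperator_rankOne (hφ : ‖φ‖ = 1) :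
    IsDensityOperator (InnerProductSpace.rankOne ℂ φ φ) where
  isPositive := InnerProductSpace.isPositive_rankOne_self φ
  hasSum_one := by
    have h := (basis 𝓗).hasSum_inner_mul_inner φ φ
    rw [inner_self_eq_norm_sq_to_K, hφ] at h
    simpa [mul_comm] using h

theorem trace_mul_rankOne_mul (φ : 𝓗) (S T : 𝓗 →L[ℂ] 𝓗) :
    trace (S * InnerProductSpace.rankOne ℂ φ φ * T) = inner ℂ φ (T (S φ)) := by
  rw [← ContinuousLinearMap.adjoint_inner_left, ← (basis 𝓗).tsum_inner_mul_inner]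
  refine tsum_congr fun i => ?_
  rw [mul_apply_eq_comp, mul_apply_eq_comp, InnerProductSpace.rankOne_apply, map_smul,
    inner_smul_right, ContinuousLinearMap.adjoint_inner_left]

theorem re_inner_rankOne_self_apply {E : Type*} [NormedAddCommGroup E] [InnerProductSpace ℂ E]
    (φ ψ : E) : (inner ℂ ψ (InnerProductSpace.rankOne ℂ φ φ ψ)).re = ‖inner ℂ φ ψ‖ ^ 2 := by
  rw [InnerProductSpace.rankOne_apply, inner_smul_right, ← inner_conj_symm ψ φ, Complex.mul_conj,
    Complex.normSq_eq_norm_sq, Complex.ofReal_re]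

namespace Realization

variable {X A : Type*} [Fintype A] {R : Realization 𝓗 X A}

theorem timeline_of_state_eq_rankOne (hR : R.state = InnerProductSpace.rankOne ℂ φ φ) (x : X)
    (a : A) (t : ℝ) : R.timeline x a t
      = (inner ℂ (R.spec.evolution t φ) (R.meas x a (R.spec.evolution t φ))).re := by
  rw [timeline, hR, mul_assoc, trace_mul_rankOne_mul, mul_apply_eq_comp,
    ← R.spec.star_evolution, ContinuousLinearMap.star_eq_adjoint,
    ContinuousLinearMap.adjoint_inner_right]

theorem highEnergyProb_of_state_eq_rankOne (hR : R.state = InnerProductSpace.rankOne ℂ φ φ)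
    (Eplus : ℝ) : R.highEnergyProb Eplus = ‖R.spec.proj (Set.Ici Eplus) φ‖ ^ 2 := by
  rw [highEnergyProb, hR, ← one_mul (InnerProductSpace.rankOne ℂ φ φ), trace_mul_rankOne_mul,
    one_apply_eq_self, R.spec.inner_proj measurableSet_Ici, Complex.ofReal_re]

end Realization

end PureState

section Qubit

theorem sq_norm_ketPlus_apply (i : Fin 2) : ‖ketPlus i‖ ^ 2 = 1 / 2 := by
  fin_cases i <;> simp [ketPlus]

theorem norm_ketPlus : ‖ketPlus‖ = 1 := by
  rw [← sq_eq_sq₀ (norm_nonneg _) zero_le_one, EuclideanSpace.norm_sq_eq]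
  simp only [sq_norm_ketPlus_apply, Fin.sum_univ_two]
  norm_num

theorem isStarProjection_ketbra_ketPlus : IsStarProjection (ketbra ketPlus) :=
  InnerProductSpace.isStarProjection_rankOne_self norm_ketPlus

theorem qubitHam_eq_toPMap_diagOp (Δ : ℝ) (m : ℕ) :
    qubitHam Δ m = LinearMap.toPMap
      (diagOp fun i => ((![0, (2 * (m : ℝ) + 1) * Real.pi / Δ] i : ℝ) : ℂ) :
        EuclideanSpace ℂ (Fin 2) →ₗ[ℂ] EuclideanSpace ℂ (Fin 2)) ⊤ := by
  rw [qubitHam]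
  congr 2
  ext ψ i
  fin_cases i <;> simp [diagOp_apply, ketbra, ketOne, PiLp.inner_apply]

/-- The qubit with energies `0` and `ω`, prepared in the state `|+⟩` and measured in a basis
containing `|+⟩`. -/
noncomputable def qubitRealization (ω : ℝ) (hω : 0 ≤ ω) :
    Realization (EuclideanSpace ℂ (Fin 2)) (Fin 1) (Fin 2) where
  state := ketbra ketPlus
  isDensityOperator_state := isDensityOperator_rankOne norm_ketPlus
  ham := LinearMap.toPMap (diagOp fun i => ((![0, ω] i : ℝ) : ℂ) :
    EuclideanSpace ℂ (Fin 2) →ₗ[ℂ] EuclideanSpace ℂ (Fin 2)) ⊤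
  isSelfAdjoint_ham := isSelfAdjoint_toPMap_diagOp _
  ham_nonneg ψ := by
    rw [(isResolutionOf_diagSpec _).inner_apply, Complex.ofReal_re, integral_measure_diagSpec]
    refine Finset.sum_nonneg fun i _ => smul_nonneg (by positivity) ?_
    fin_cases i
    exacts [le_rfl, hω]
  spec := diagSpec ![0, ω]
  isResolutionOf_spec := isResolutionOf_diagSpec _
  meas _ := ![ketbra ketPlus, 1 - ketbra ketPlus]
  isPositive_meas _ a := by
    fin_cases a
    exacts [.of_isStarProjection isStarProjection_ketbra_ketPlus,
      .of_isStarProjection isStarProjection_ketbra_ketPlus.one_sub]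
  sum_meas _ := by simp [Fin.sum_univ_two]

variable {ω : ℝ} (hω : 0 ≤ ω)

theorem highEnergyProb_qubitRealization_le {Eplus : ℝ} (hE : 0 < Eplus) :
    (qubitRealization ω hω).highEnergyProb Eplus ≤ 1 / 2 := by
  have hground : (0 : ℝ) ∉ Set.Ici Eplus := not_le.2 hE
  rw [Realization.highEnergyProb_of_state_eq_rankOne (φ := ketPlus) rfl]
  simp only [qubitRealization, diagSpec, sq_norm_diagOp_apply, sq_norm_ketPlus_apply,
    Fin.sum_univ_two, Matrix.cons_val_zero, Matrix.cons_val_one, Set.indicator_of_notMem hground]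
  by_cases hexcited : ω ∈ Set.Ici Eplus <;> simp [hexcited]

theorem inner_ketPlus_evolution_ketPlus (ω t : ℝ) :
    inner ℂ ketPlus ((diagSpec ![0, ω]).evolution t ketPlus)
      = (1 + Complex.exp (-Complex.I * ω * t)) / 2 := by
  rw [evolution_diagSpec, inner_diagOp_apply, Fin.sum_univ_two]
  simp only [sq_norm_ketPlus_apply, Matrix.cons_val_zero, Matrix.cons_val_one, Complex.ofReal_zero,
    mul_zero, zero_mul, Complex.exp_zero, Complex.real_smul]
  push_cast
  ring

theorem sq_norm_one_add_div_two {z : ℂ} (hz : ‖z‖ = 1) : ‖(1 + z) / 2‖ ^ 2 = (1 + z.re) / 2 := by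
  rw [norm_div, div_pow, Complex.sq_norm, Complex.normSq_add, Complex.normSq_one, one_mul,
    Complex.conj_re, Complex.normSq_eq_norm_sq, hz, Complex.norm_two]
  ring

theorem timeline_qubitRealization_zero (t : ℝ) :
    (qubitRealization ω hω).timeline 0 0 t = (1 + Real.cos (ω * t)) / 2 := by
  calc (qubitRealization ω hω).timeline 0 0 t
      = ‖inner ℂ ketPlus ((diagSpec ![0, ω]).evolution t ketPlus)‖ ^ 2 := by
        rw [Realization.timeline_of_state_eq_rankOne (φ := ketPlus) rfl]
        exact re_inner_rankOne_self_apply _ _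
    _ = (1 + Real.cos (ω * t)) / 2 := by
        rw [inner_ketPlus_evolution_ketPlus,
          sq_norm_one_add_div_two (by simp [Complex.norm_exp])]
        simp [Complex.exp_re]

theorem timeline_qubitRealization_one (t : ℝ) :
    (qubitRealization ω hω).timeline 0 1 t = (1 - Real.cos (ω * t)) / 2 := by
  have hsum : (qubitRealization ω hω).timeline 0 0 t + (qubitRealization ω hω).timeline 0 1 t
      = ‖(diagSpec ![0, ω]).evolution t ketPlus‖ ^ 2 := by
    rw [Realization.timeline_of_state_eq_rankOne (φ := ketPlus) rfl,
      Realization.timeline_of_state_eq_rankOne (φ := ketPlus) rfl, ← Complex.add_re,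
      ← inner_add_right, ← add_apply, ← Fin.sum_univ_two fun a => (qubitRealization ω hω).meas 0 a,
      Realization.sum_meas, one_apply_eq_self]
    exact inner_self_eq_norm_sq (𝕜 := ℂ) ((diagSpec ![0, ω]).evolution t ketPlus)
  rw [norm_evolution_diagSpec_apply, norm_ketPlus, timeline_qubitRealization_zero] at hsum
  linarith

theorem fitsFlip_timeline_qubitRealization {Δ : ℝ} (hflip : Real.cos (ω * Δ) = -1) :
    FitsFlip Δ 0 (qubitRealization ω hω).timeline := by
  simp [fitsFlip_iff, timeline_qubitRealization_zero, timeline_qubitRealization_one, hflip]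

theorem timeline_qubitRealization_mem_softSupportSet {Eplus : ℝ} (hE : 0 < Eplus) :
    (qubitRealization ω hω).timeline ∈ softSupportSet (Fin 1) (Fin 2) Eplus (1 / 2) :=
  ⟨_, _, _, _, qubitRealization ω hω, highEnergyProb_qubitRealization_le hω hE, rfl⟩

theorem extendedDataset_eq_timeline_qubitRealization {Δ τ : ℝ} (hΔ : Real.cos (ω * Δ) = -1)
    (hτ : Real.cos (ω * τ) = -1) :
    extendedDataset = fun x a j => (qubitRealization ω hω).timeline x a (![0, Δ, τ] j) := by
  ext x a j
  fin_cases x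
  fin_cases a <;> fin_cases j <;>
    simp [extendedDataset, timeline_qubitRealization_zero, timeline_qubitRealization_one, hΔ, hτ]

end Qubit

section FlipFrequency

variable {Eplus Δ δ : ℝ}

theorem cos_odd_mul_pi_div_mul_self (hΔ : Δ ≠ 0) (m : ℕ) :
    Real.cos ((2 * (m : ℝ) + 1) * Real.pi / Δ * Δ) = -1 := by
  rw [div_mul_cancel₀ _ hΔ, show (2 * (m : ℝ) + 1) * Real.pi = Real.pi + m * (2 * Real.pi) by ring,
    Real.cos_add_nat_mul_two_pi, Real.cos_pi]

theorem cos_odd_mul_pi_div_mul_tau (hΔ : Δ ≠ 0) (m : ℕ) :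
    Real.cos ((2 * (m : ℝ) + 1) * Real.pi / Δ * tau Δ m) = -1 := by
  have hphase : (2 * (m : ℝ) + 1) * Real.pi / Δ * tau Δ m
      = Real.pi + ((2 * m + 1 : ℕ) : ℝ) * (2 * Real.pi) := by
    rw [tau]
    push_cast
    field_simp
    ring
  rw [hphase, Real.cos_add_nat_mul_two_pi, Real.cos_pi]

theorem extendedDataset_mem_softSupportDatasets_tau (hE : 0 < Eplus) (hΔ : 0 < Δ) (m : ℕ) :
    extendedDataset ∈ softSupportDatasets (Fin 1) (Fin 2) Eplus (1 / 2) ![0, Δ, tau Δ m] := by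
  have hω : 0 ≤ (2 * (m : ℝ) + 1) * Real.pi / Δ := by positivity
  exact ⟨_, timeline_qubitRealization_mem_softSupportSet hω hE,
    extendedDataset_eq_timeline_qubitRealization hω (cos_odd_mul_pi_div_mul_self hΔ.ne' m)
      (cos_odd_mul_pi_div_mul_tau hΔ.ne' m)⟩

theorem FitsFlip.mono {δ' : ℝ} {P : Fin 1 → Fin 2 → ℝ → ℝ} (h : FitsFlip Δ δ P) (hδ : δ ≤ δ') :
    FitsFlip Δ δ' P :=
  fun x j => (h x j).trans hδ

theorem exists_realization_qubitHam (hE : 0 < Eplus) (hΔ : 0 < Δ) (m : ℕ) :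
    ∃ R : Realization (EuclideanSpace ℂ (Fin 2)) (Fin 1) (Fin 2),
      R.state = ketbra ketPlus ∧ R.ham = qubitHam Δ m ∧
      R.meas 0 0 = ketbra ketPlus ∧ R.meas 0 1 = 1 - ketbra ketPlus ∧
      R.highEnergyProb Eplus ≤ 1 / 2 ∧ FitsFlip Δ 0 R.timeline ∧
      R.timeline 0 0 (tau Δ m) = 0 := by
  have hω : 0 ≤ (2 * (m : ℝ) + 1) * Real.pi / Δ := by positivity
  refine ⟨qubitRealization _ hω, rfl, (qubitHam_eq_toPMap_diagOp Δ m).symm, rfl, rfl,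
    highEnergyProb_qubitRealization_le hω hE,
    fitsFlip_timeline_qubitRealization hω (cos_odd_mul_pi_div_mul_self hΔ.ne' m), ?_⟩
  rw [timeline_qubitRealization_zero, cos_odd_mul_pi_div_mul_tau hΔ.ne' m]
  norm_num

theorem isLeast_timeline_tau (hE : 0 < Eplus) (hΔ : 0 < Δ) (hδ : 0 ≤ δ) (m : ℕ) :
    IsLeast {p : ℝ | ∃ P ∈ softSupportSet (Fin 1) (Fin 2) Eplus (1 / 2),
      FitsFlip Δ δ P ∧ p = P 0 0 (tau Δ m)} 0 := by
  obtain ⟨R, -, -, -, -, henergy, hfits, hτ⟩ := exists_realization_qubitHam hE hΔ m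
  refine ⟨⟨R.timeline, ⟨_, _, _, _, R, henergy, rfl⟩, hfits.mono hδ, hτ.symm⟩, ?_⟩
  rintro p ⟨P, ⟨𝓗, _, _, _, R', -, rfl⟩, -, rfl⟩
  exact R'.timeline_nonneg _ _ _

theorem tendsto_tau (Δ : ℝ) : Tendsto (tau Δ) atTop (𝓝 (2 * Δ)) := by
  have hodd : Tendsto (fun m : ℕ => 2 * (m : ℝ) + 1) atTop atTop :=
    tendsto_atTop_add_const_right _ _
      (tendsto_natCast_atTop_atTop.const_mul_atTop (by norm_num))
  simpa only [add_zero] using! (tendsto_const_nhds (x := 2 * Δ)).add (hodd.const_div_atTop Δ)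

end FlipFrequency

section Discontinuity

theorem not_tendsto_hausdorffEDist_of_notMem_closure {T M : Type*} [PseudoEMetricSpace M]
    {S : T → Set M} {s : Set M} {l : Filter T} {x : M} (hx : ∃ᶠ t in l, x ∈ S t)
    (hs : x ∉ closure s) : ¬ Tendsto (fun t => Metric.hausdorffEDist (S t) s) l (𝓝 0) := by
  intro htendsto
  refine hs (Metric.mem_closure_iff_infEDist_zero.2 (nonpos_iff_eq_zero.1 ?_))
  exact ge_of_tendsto_of_frequently htendsto
    (hx.mono fun t ht => Metric.infEDist_le_hausdorffEDist_of_mem ht)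

/-- The `ℓ¹` distance between the columns of `Q` at the first two measurement times and
`flipDataset`. It is an error bar within which `Q` fits `flipDataset` and is continuous in `Q`, so
that bounds depending on the error bar pass to limits of datasets. -/
def flipError (Q : Fin 1 → Fin 2 → Fin 3 → ℝ) : ℝ :=
  |Q 0 0 0 - 1| + |Q 0 1 0| + (|Q 0 0 1| + |Q 0 1 1 - 1|)

theorem closure_softSupportDatasets_subset (Eplus Δ : ℝ) :
    closure (softSupportDatasets (Fin 1) (Fin 2) Eplus (1 / 2) ![0, Δ, 2 * Δ])
      ⊆ {Q | 1 - Q 0 0 2 ≤ √(130 * √(flipError Q) + 64 * (Eplus * Δ) ^ 2)} := by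
  refine closure_minimal ?_ (isClosed_le (by fun_prop) (by unfold flipError; fun_prop))
  rintro _ ⟨P, hP, rfl⟩
  exact one_sub_apply_two_mul_le_sqrt (by unfold flipError; positivity) hP
    (fitsFlip_iff.2 ⟨le_add_of_nonneg_right (by positivity), le_add_of_nonneg_left (by positivity)⟩)

theorem flipError_extendedDataset : flipError extendedDataset = 0 := by
  simp [flipError, extendedDataset]

variable {Eplus Δ : ℝ}

theorem extendedDataset_notMem_closure (hE : 0 < Eplus) (hΔ : 0 < Δ) (h : Eplus * Δ ≤ 1 / 16) :
    extendedDataset ∉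
      closure (softSupportDatasets (Fin 1) (Fin 2) Eplus (1 / 2) ![0, Δ, 2 * Δ]) := by
  intro hmem
  have hbound : 1 - (0 : ℝ) ≤ √(130 * √(flipError extendedDataset) + 64 * (Eplus * Δ) ^ 2) :=
    closure_softSupportDatasets_subset Eplus Δ hmem
  rw [flipError_extendedDataset, Real.sqrt_zero, mul_zero, zero_add, sub_zero,
    Real.one_le_sqrt] at hbound
  have hsq : (Eplus * Δ) ^ 2 ≤ (1 / 16) ^ 2 := by gcongr
  linarith

theorem frequently_extendedDataset_mem_softSupportDatasets (hE : 0 < Eplus) (hΔ : 0 < Δ) :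
    ∃ᶠ t in 𝓝 ![0, Δ, 2 * Δ],
      extendedDataset ∈ softSupportDatasets (Fin 1) (Fin 2) Eplus (1 / 2) t := by
  have htau : Tendsto (fun m => ![0, Δ, tau Δ m]) atTop (𝓝 ![0, Δ, 2 * Δ]) :=
    tendsto_const_nhds.matrixVecCons
      (tendsto_const_nhds.matrixVecCons ((tendsto_tau Δ).matrixVecCons tendsto_const_nhds))
  exact htau.frequently
    (Frequently.of_forall fun m => extendedDataset_mem_softSupportDatasets_tau hE hΔ m)

end Discontinuity

end TimedMeasurement

theorem mainTheorem12 :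
    (∃ C₁ C₂ : ℝ, 0 < C₁ ∧ 0 < C₂ ∧
      ∀ Eplus Δ δ : ℝ, 0 < Eplus → 0 < Δ → Δ ≤ Real.pi / (2 * Eplus) → 0 ≤ δ →
        ∀ P ∈ softSupportSet (Fin 1) (Fin 2) Eplus (1 / 2), FitsFlip Δ δ P →
          1 - P 0 0 (2 * Δ) ≤ √(C₁ * √δ + C₂ * (Eplus * Δ) ^ 2)) ∧
    (∀ Eplus Δ : ℝ, 0 < Eplus → 0 < Δ →
      (∀ m : ℕ,
        (∃ R : Realization (EuclideanSpace ℂ (Fin 2)) (Fin 1) (Fin 2),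
          R.state = ketbra ketPlus ∧ R.ham = qubitHam Δ m ∧
          R.meas 0 0 = ketbra ketPlus ∧ R.meas 0 1 = 1 - ketbra ketPlus ∧
          R.highEnergyProb Eplus ≤ 1 / 2 ∧ FitsFlip Δ 0 R.timeline ∧
          R.timeline 0 0 (tau Δ m) = 0) ∧
        (∀ δ : ℝ, 0 ≤ δ →
          IsLeast {p : ℝ | ∃ P ∈ softSupportSet (Fin 1) (Fin 2) Eplus (1 / 2),
            FitsFlip Δ δ P ∧ p = P 0 0 (tau Δ m)} 0) ∧
        extendedDataset ∈
          softSupportDatasets (Fin 1) (Fin 2) Eplus (1 / 2) ![0, Δ, tau Δ m]) ∧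
      Tendsto (tau Δ) atTop (𝓝 (2 * Δ))) ∧
    (∃ c : ℝ, 0 < c ∧ ∀ Eplus Δ : ℝ, 0 < Eplus → 0 < Δ → Eplus * Δ ≤ c →
      extendedDataset ∉
        closure (softSupportDatasets (Fin 1) (Fin 2) Eplus (1 / 2) ![0, Δ, 2 * Δ]) ∧
      ¬ Tendsto
        (fun t : Fin 3 → ℝ => Metric.hausdorffEDist
          (softSupportDatasets (Fin 1) (Fin 2) Eplus (1 / 2) t)
          (softSupportDatasets (Fin 1) (Fin 2) Eplus (1 / 2) ![0, Δ, 2 * Δ]))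
        (𝓝 ![0, Δ, 2 * Δ]) (𝓝 0)) := by
  refine ⟨⟨130, 64, by norm_num, by norm_num, fun Eplus Δ δ _ _ _ hδ P hP hfits =>
      one_sub_apply_two_mul_le_sqrt hδ hP hfits⟩,
    fun Eplus Δ hE hΔ => ⟨fun m => ⟨exists_realization_qubitHam hE hΔ m,
      fun δ hδ => isLeast_timeline_tau hE hΔ hδ m,
      extendedDataset_mem_softSupportDatasets_tau hE hΔ m⟩, tendsto_tau Δ⟩,
    ⟨1 / 16, by norm_num, fun Eplus Δ hE hΔ hsmall => ?_⟩⟩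
  have hnotMem := extendedDataset_notMem_closure hE hΔ hsmall
  exact ⟨hnotMem, not_tendsto_hausdorffEDist_of_notMem_closure
    (frequently_extendedDataset_mem_softSupportDatasets hE hΔ) hnotMem⟩
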